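/- Let $A=\mathrm{PSL}(2,\mathbb C)=\mathrm{SL}(2,\mathbb C)/\{\pm I\}$, regarded as a complex affine algebraic group, let $p,t$ be positive integers and let $G_{pt}=\langle x,y \mid x^p=y^t\rangle$. Let $R_A(G_{pt})=\mathrm{Hom}(G_{pt},A)$ be the representation variety of $G_{pt}$ over $A$, that is, the algebraic set obtained by identifying $\rho\in\mathrm{Hom}(G_{pt},A)$ with the point $(\rho(x),\rho(y))\in A^2$, with its Zariski topology. For an algebraic variety $V$ (not necessarily irreducible) let $N_4(V)$ be the number of irreducible components of $V$ of dimension exactly $4$. Then $N_4(R_A(G_{pt}))$ is finite and equals 1. $\dfrac{(p-1)(t-1)}{4}$ if both $p$ and $t$ are odd; 2. $\dfrac{p(t-1)}{4}$ if $p$ is even and $t$ is odd; 3. $\dfrac{t(p-1)}{4}$ if $p$ is odd and $t$ is even; 4. $\dfrac{pt}{4}$ if both $p$ and $t$ are even. -/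

import Mathlib

/-- The Zariski topology on a set `X` equipped with a `ℂ`-algebra `R` of (regular) functions
`X → ℂ`: the closed sets are the common zero loci of the subsets of `R`. -/
@[reducible] def zariskiTopology {X : Type} (R : Subalgebra ℂ (X → ℂ)) : TopologicalSpace X :=
  TopologicalSpace.ofClosed
    {Z : Set X | ∃ S : Set (X → ℂ), S ⊆ (R : Set (X → ℂ)) ∧ Z = {x | ∀ f ∈ S, f x = 0}}
    ⟨{1}, by
      simp, by
      ext x; simp⟩
    (by
      intro A hA
      refine ⟨{f | f ∈ R ∧ ∃ Z ∈ A, ∀ x ∈ Z, f x = 0}, fun f hf => hf.1, ?_⟩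
      ext x
      constructor
      · rintro hx f ⟨-, Z, hZ, hf⟩
        exact hf x (hx Z hZ)
      · intro hx Z hZ
        obtain ⟨S, hS, rfl⟩ := hA hZ
        exact fun f hf => hx f ⟨hS hf, _, hZ, fun y hy => hy f hf⟩)
    (by
      rintro _ ⟨S, hS, rfl⟩ _ ⟨T, hT, rfl⟩
      refine ⟨{h | ∃ f ∈ S, ∃ g ∈ T, h = f * g}, ?_, ?_⟩
      · rintro _ ⟨f, hf, g, hg, rfl⟩
        exact R.mul_mem (hS hf) (hT hg)
      · ext x
        constructor
        · rintro (hx | hx) _ ⟨f, hf, g, hg, rfl⟩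
          · simp [hx f hf]
          · simp [hx g hg]
        · intro hx
          by_contra hcon
          simp only [Set.mem_union, Set.mem_ofPred_eq, not_or, not_forall] at hcon
          obtain ⟨⟨f, hf, hfx⟩, ⟨g, hg, hgx⟩⟩ := hcon
          exact mul_ne_zero hfx hgx (hx _ ⟨f, hf, g, hg, rfl⟩))

/-- The group `PSL(2, ℂ)`, the quotient of `SL(2, ℂ)` by its center `{I, -I}`. -/
abbrev PSL2C : Type := Matrix.ProjectiveSpecialLinearGroup (Fin 2) ℂ

/-- The product `PSL(2, ℂ)ⁿ`, as a type of its own so that it can carry the Zariski topology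
(and not the product of the classical topologies). -/
def PSL2CPow (n : ℕ) : Type := Fin n → PSL2C

/-- The canonical projection `SL(2, ℂ)ⁿ → PSL(2, ℂ)ⁿ`. -/
def projPow (n : ℕ) (g : Fin n → Matrix.SpecialLinearGroup (Fin 2) ℂ) : PSL2CPow n :=
  fun i => (QuotientGroup.mk (g i) : PSL2C)

/-- The coordinate algebra of the affine variety `PSL(2, ℂ)ⁿ = SL(2, ℂ)ⁿ / {I, -I}ⁿ`: a function
is regular iff its pullback to `SL(2, ℂ)ⁿ` is a polynomial in the matrix entries. -/
def regularFunctions (n : ℕ) : Subalgebra ℂ (PSL2CPow n → ℂ) where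
  carrier := {f | ∃ P : MvPolynomial (Fin n × Fin 2 × Fin 2) ℂ,
    ∀ g : Fin n → Matrix.SpecialLinearGroup (Fin 2) ℂ,
      f (projPow n g) = MvPolynomial.eval (fun k => (g k.1).1 k.2.1 k.2.2) P}
  mul_mem' := by
    rintro f f' ⟨P, hP⟩ ⟨P', hP'⟩
    exact ⟨P * P', fun g => by simp [hP, hP']⟩
  add_mem' := by
    rintro f f' ⟨P, hP⟩ ⟨P', hP'⟩
    exact ⟨P + P', fun g => by simp [hP, hP']⟩
  algebraMap_mem' := fun c => ⟨MvPolynomial.C c, fun g => by simp⟩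

instance PSL2CPow.instTopologicalSpace (n : ℕ) : TopologicalSpace (PSL2CPow n) :=
  zariskiTopology (regularFunctions n)

/-- The representation variety `R_A(G) = Hom(G, A)` for `A = PSL(2, ℂ)`, where the group `G` is
generated by `s 0, …, s (n - 1)`. -/
def RepVariety {G : Type} [Group G] {n : ℕ} (_s : Fin n → G) : Type := G →* PSL2C

/-- The inclusion `Hom(G, A) → Aⁿ`, `ρ ↦ (ρ (s 0), …, ρ (s (n - 1)))`, for `A = PSL(2, ℂ)`. -/
def RepVariety.toPow {G : Type} [Group G] {n : ℕ} (s : Fin n → G) (ρ : RepVariety s) :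
    PSL2CPow n :=
  fun i => (show G →* PSL2C from ρ) (s i)

/-- The Zariski topology of `R_A(G)` is the subspace topology from `Aⁿ`. -/
instance RepVariety.instTopologicalSpace {G : Type} [Group G] {n : ℕ} (s : Fin n → G) :
    TopologicalSpace (RepVariety s) :=
  TopologicalSpace.induced (RepVariety.toPow s) inferInstance

/-- `N_d(X)`: the number of irreducible components of `X` of (Krull) dimension exactly `d`. -/
noncomputable def numComponents (X : Type) [TopologicalSpace X] (d : ℕ) : ℕ∞ :=
  {Z ∈ irreducibleComponents X | topologicalKrullDim Z = (d : WithBot ℕ∞)}.encard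

/-- The group `G_{pt} = ⟨x, y ; x ^ p = y ^ t⟩`, with `x`, `y` the generators `0`, `1`. -/
abbrev torusGroup (p t : ℕ) : Type :=
  PresentedGroup
    ({FreeGroup.of 0 ^ p * (FreeGroup.of 1 ^ t)⁻¹} : Set (FreeGroup (Fin 2)))

/-- The generators `x`, `y` of `G_{pt}`. -/
def torusGroupGen (p t : ℕ) : Fin 2 → torusGroup p t :=
  fun i => PresentedGroup.of i

/-! Lift a representation to matrices `A`, `B` in `SL(2, ℂ)` with `A ^ p = ± B ^ t`. If `A` and `B`
do not commute, then `A ^ p`, which commutes with both, must be scalar, hence `± 1`. So `A` and `B`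
are nonscalar of finite order in `PSL(2, ℂ)`, their eigenvalue ratios are nontrivial roots of unity
of order dividing `p` and `t`, and their squared traces take one of `p / 2` and `t / 2` values, a
root and its inverse giving the same value (`mem_commutingReps_or_traceReps`).

The variety is thus a finite union of closed sets: `commutingReps` and the strata `traceReps p t K`.
The strata are irreducible, pairwise disjoint, of dimension 4 and not inside the commuting locus,
whose irreducible subsets have dimension at most 3. Hence the strata are exactly the 4-dimensional
components, and there are `p / 2 * (t / 2)` of them.

Dimensions are computed with functions alone. The upper bound is `exists_eval_ne_zero_of_chain`: a
long chain of irreducible sets yields algebraically independent functions, whereas a set covered by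
finitely many charts with `d` parameters admits at most `d`. The lower bound is an explicit flag in
a polynomial parametrization. -/

/-- A subalgebra `F` of functions on a space `Y` cuts out its topology: the closed sets are the
common zero loci of subsets of `F`. -/
def IsZariski {Y : Type} [TopologicalSpace Y] (F : Subalgebra ℂ (Y → ℂ)) : Prop :=
  ∀ C : Set Y, IsClosed C ↔ ∃ S : Set (Y → ℂ), S ⊆ (F : Set (Y → ℂ)) ∧ C = {y | ∀ f ∈ S, f y = 0}

theorem eval_aeval {σ τ : Type} (E : σ → MvPolynomial τ ℂ) (P : MvPolynomial σ ℂ) (z : τ → ℂ) :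
    MvPolynomial.eval z (MvPolynomial.aeval E P) =
      MvPolynomial.eval (fun k => MvPolynomial.eval z (E k)) P := by
  have h := MvPolynomial.comp_aeval_apply E (MvPolynomial.aeval (R := ℂ) z) P
  simpa [MvPolynomial.aeval_eq_eval] using h

/-- Composition with `ι` as a homomorphism of function algebras. -/
def pullbackAlgHom {X Y : Type} (ι : Y → X) : (X → ℂ) →ₐ[ℂ] (Y → ℂ) :=
  AlgHom.pi fun y => Pi.evalAlgHom ℂ _ (ι y)

theorem pullbackAlgHom_apply {X Y : Type} (ι : Y → X) (f : X → ℂ) (y : Y) :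
    pullbackAlgHom ι f y = f (ι y) := rfl

theorem mvPolynomial_eval_mem {Y : Type} {F : Subalgebra ℂ (Y → ℂ)} {σ : Type}
    {f : σ → Y → ℂ} (hf : ∀ i, f i ∈ F) (P : MvPolynomial σ ℂ) :
    (fun y => MvPolynomial.eval (fun i => f i y) P) ∈ F := by
  induction P using MvPolynomial.induction_on with
  | C a =>
    simp only [MvPolynomial.eval_C]
    exact F.algebraMap_mem a
  | add p q hp hq =>
    simp only [map_add]
    exact F.add_mem hp hq
  | mul_X p i hp =>
    simp only [map_mul, MvPolynomial.eval_X]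
    exact F.mul_mem hp (hf i)

/-! ### Algebraic dependence of functions on a set -/

/-- Any `d + 1` functions in `F` are algebraically dependent on `S`. -/
def AlgDependentOn {Y : Type} (F : Subalgebra ℂ (Y → ℂ)) (d : ℕ) (S : Set Y) : Prop :=
  ∀ f : Fin (d + 1) → Y → ℂ, (∀ i, f i ∈ F) →
    ∃ P : MvPolynomial (Fin (d + 1)) ℂ, P ≠ 0 ∧
      ∀ y ∈ S, MvPolynomial.eval (fun i => f i y) P = 0

namespace AlgDependentOn

variable {Y : Type} {F : Subalgebra ℂ (Y → ℂ)} {d : ℕ}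

theorem mono {S T : Set Y} (hT : AlgDependentOn F d T) (h : S ⊆ T) : AlgDependentOn F d S := by
  intro f hf
  obtain ⟨P, hP, hPT⟩ := hT f hf
  exact ⟨P, hP, fun y hy => hPT y (h hy)⟩

theorem biUnion {ι : Type} (s : Finset ι) {S : ι → Set Y}
    (h : ∀ i ∈ s, AlgDependentOn F d (S i)) : AlgDependentOn F d (⋃ i ∈ s, S i) := by
  intro f hf
  choose! P hP hPS using fun i (hi : i ∈ s) => h i hi f hf
  refine ⟨∏ i ∈ s, P i, Finset.prod_ne_zero_iff.2 hP, fun y hy => ?_⟩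
  simp only [Set.mem_iUnion] at hy
  obtain ⟨i, hi, hy⟩ := hy
  rw [map_prod]
  exact Finset.prod_eq_zero hi (hPS i hi y hy)

theorem union {S T : Set Y} (hS : AlgDependentOn F d S) (hT : AlgDependentOn F d T) :
    AlgDependentOn F d (S ∪ T) := by
  intro f hf
  obtain ⟨P, hP, hPS⟩ := hS f hf
  obtain ⟨Q, hQ, hQT⟩ := hT f hf
  refine ⟨P * Q, mul_ne_zero hP hQ, ?_⟩
  rintro y (hy | hy)
  · simp [hPS y hy]
  · simp [hQT y hy]

theorem preimage {X : Type} {S : Set Y} (h : AlgDependentOn F d S) (ι : X → Y) :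
    AlgDependentOn (F.map (pullbackAlgHom ι)) d (ι ⁻¹' S) := by
  intro f hf
  choose g hg hgf using hf
  obtain ⟨P, hP, hPS⟩ := h g hg
  refine ⟨P, hP, fun x hx => ?_⟩
  rw [← hPS (ι x) hx]
  congr 2
  funext i
  rw [← hgf i]
  rfl

end AlgDependentOn

/-! ### Irreducibility and Krull dimension in terms of a function algebra -/

namespace IsZariski

theorem of_zariskiTopology {X : Type} (R : Subalgebra ℂ (X → ℂ)) :
    @IsZariski X (zariskiTopology R) R := by
  intro C
  let _ := zariskiTopology R
  rw [← isOpen_compl_iff]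
  change Cᶜᶜ ∈ _ ↔ _
  rw [compl_compl]
  rfl

theorem pullback {X Y : Type} [TopologicalSpace X] [TopologicalSpace Y]
    {F : Subalgebra ℂ (X → ℂ)} (hF : IsZariski F) {ι : Y → X} (hι : Topology.IsInducing ι) :
    IsZariski (F.map (pullbackAlgHom ι)) := by
  intro C
  rw [hι.isClosed_iff]
  constructor
  · rintro ⟨D, hD, rfl⟩
    obtain ⟨S, hS, rfl⟩ := (hF D).1 hD
    refine ⟨pullbackAlgHom ι '' S, ?_, ?_⟩
    · rintro _ ⟨f, hf, rfl⟩
      exact ⟨f, hS hf, rfl⟩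
    · ext y
      simp [pullbackAlgHom_apply]
  · rintro ⟨S, hS, rfl⟩
    refine ⟨{x | ∀ f ∈ {f | f ∈ F ∧ pullbackAlgHom ι f ∈ S}, f x = 0},
      (hF _).2 ⟨_, fun f hf => hf.1, rfl⟩, ?_⟩
    ext y
    constructor
    · intro h f hf
      obtain ⟨g, hg, rfl⟩ := hS hf
      exact h g ⟨hg, hf⟩
    · intro h f hf
      exact h _ hf.2

variable {Y : Type} [TopologicalSpace Y] {F : Subalgebra ℂ (Y → ℂ)}

theorem isClosed_zeros (hF : IsZariski F) {f : Y → ℂ} (hf : f ∈ F) : IsClosed {y | f y = 0} :=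
  (hF _).2 ⟨{f}, by simpa using hf, by simp⟩

theorem exists_separating (hF : IsZariski F) {C : Set Y} (hC : IsClosed C) {y : Y} (hy : y ∉ C) :
    ∃ f ∈ F, (∀ z ∈ C, f z = 0) ∧ f y ≠ 0 := by
  obtain ⟨S, hS, rfl⟩ := (hF C).1 hC
  simp only [Set.mem_ofPred_eq, not_forall] at hy
  obtain ⟨f, hf, hfy⟩ := hy
  exact ⟨f, hS hf, fun z hz => hz f hf, hfy⟩

theorem vanishes_or_vanishes (hF : IsZariski F) {W : Set Y} (hW : IsIrreducible W) {f g : Y → ℂ}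
    (hf : f ∈ F) (hg : g ∈ F) (h : ∀ y ∈ W, f y * g y = 0) :
    (∀ y ∈ W, f y = 0) ∨ (∀ y ∈ W, g y = 0) :=
  isPreirreducible_iff_isClosed_union_isClosed.1 hW.isPreirreducible _ _
    (hF.isClosed_zeros hf) (hF.isClosed_zeros hg) fun y hy => mul_eq_zero.1 (h y hy)

theorem isIrreducible_of_vanishes (hF : IsZariski F) {W : Set Y} (hne : W.Nonempty)
    (h : ∀ f ∈ F, ∀ g ∈ F, (∀ y ∈ W, f y * g y = 0) →
      (∀ y ∈ W, f y = 0) ∨ (∀ y ∈ W, g y = 0)) : IsIrreducible W := by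
  refine ⟨hne, isPreirreducible_iff_isClosed_union_isClosed.2 fun C D hC hD hCD => ?_⟩
  by_contra! hcon
  obtain ⟨⟨a, ha, haC⟩, ⟨b, hb, hbD⟩⟩ :=
    And.intro (Set.not_subset.1 hcon.1) (Set.not_subset.1 hcon.2)
  obtain ⟨f, hf, hfC, hfa⟩ := hF.exists_separating hC haC
  obtain ⟨g, hg, hgD, hgb⟩ := hF.exists_separating hD hbD
  rcases h f hf g hg (fun y hy => by
    rcases hCD hy with hy | hy
    · simp [hfC y hy]
    · simp [hgD y hy]) with h | h
  · exact hfa (h a ha)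
  · exact hgb (h b hb)

/-- The image of a map from an affine space that pulls functions back to polynomials is
irreducible. -/
theorem isIrreducible_range (hF : IsZariski F) {σ : Type} (φ : (σ → ℂ) → Y)
    (hφ : ∀ f ∈ F, ∃ P : MvPolynomial σ ℂ, ∀ z, f (φ z) = MvPolynomial.eval z P) :
    IsIrreducible (Set.range φ) := by
  refine hF.isIrreducible_of_vanishes ⟨φ 0, 0, rfl⟩ fun f hf g hg h => ?_
  obtain ⟨P, hP⟩ := hφ f hf
  obtain ⟨Q, hQ⟩ := hφ g hg
  have hPQ : P * Q = 0 := MvPolynomial.funext fun z => by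
    simpa [hP, hQ] using h (φ z) ⟨z, rfl⟩
  rcases mul_eq_zero.1 hPQ with h0 | h0
  · left
    rintro _ ⟨z, rfl⟩
    simp [hP, h0]
  · right
    rintro _ ⟨z, rfl⟩
    simp [hQ, h0]

/-- The functions cutting down a chain of irreducible sets are algebraically independent on the
largest one. Given a relation, divide it by the highest power of the first variable: by
irreducibility the quotient still vanishes on `W 0`. On `W 1` the first function is zero, so only
the constant coefficient survives, a nonzero relation among the remaining functions. -/
theorem exists_eval_ne_zero_of_chain (hF : IsZariski F) (n : ℕ) :
    ∀ (P : MvPolynomial (Fin n) ℂ), P ≠ 0 → ∀ (W : Fin (n + 1) → Set Y),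
      (∀ i, IsIrreducible (W i)) → (∀ i : Fin n, W i.succ ⊆ W i.castSucc) →
      ∀ f : Fin n → Y → ℂ, (∀ i, f i ∈ F) → (∀ i : Fin n, ∀ y ∈ W i.succ, f i y = 0) →
      (∀ i : Fin n, ∃ y ∈ W i.castSucc, f i y ≠ 0) →
      ∃ y ∈ W 0, MvPolynomial.eval (fun i => f i y) P ≠ 0 := by
  induction n with
  | zero =>
    intro P hP W hW _ f _ _ _
    obtain ⟨y, hy⟩ := (hW 0).nonempty
    refine ⟨y, hy, fun h => hP ?_⟩
    rw [MvPolynomial.eq_C_of_isEmpty P] at h ⊢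
    simpa using h
  | succ n ih =>
    intro P hP W hW hanti f hf h0 h1
    by_contra! hcon
    obtain ⟨r, hr, hXr⟩ := Polynomial.exists_eq_pow_rootMultiplicity_mul_and_not_dvd
      (MvPolynomial.finSuccEquiv ℂ n P) (by simpa using hP) 0
    set k := Polynomial.rootMultiplicity 0 (MvPolynomial.finSuccEquiv ℂ n P)
    rw [Polynomial.C_0, sub_zero] at hr hXr
    rw [Polynomial.X_dvd_iff] at hXr
    have hev : ∀ (y : Y) (Q : MvPolynomial (Fin (n + 1)) ℂ),
        MvPolynomial.eval (fun i => f i y) Q = Polynomial.eval (f 0 y)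
          (Polynomial.map (MvPolynomial.eval fun i => f (Fin.succ i) y)
            (MvPolynomial.finSuccEquiv ℂ n Q)) := by
      intro y Q
      rw [← MvPolynomial.eval_eq_eval_mv_eval']
      congr 2
      funext i
      refine Fin.cases ?_ (fun i => ?_) i <;> simp
    set Q := (MvPolynomial.finSuccEquiv ℂ n).symm r with hQ
    have hfac : ∀ y ∈ W 0, (f 0 ^ k) y * MvPolynomial.eval (fun i => f i y) Q = 0 := by
      intro y hy
      rw [← hcon y hy, hev, hev, hr, hQ]
      simp
    obtain ⟨a, ha, hfa⟩ := h1 0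
    have hQ0 : ∀ y ∈ W 0, MvPolynomial.eval (fun i => f i y) Q = 0 :=
      (hF.vanishes_or_vanishes (hW 0) (F.pow_mem (hf 0) k) (mvPolynomial_eval_mem hf Q) hfac).resolve_left
        fun h => hfa (by by_contra hne; exact pow_ne_zero k hne (h a ha))
    obtain ⟨y, hy, hne⟩ := ih (r.coeff 0) hXr (fun i => W i.succ) (fun i => hW _)
      (fun i => hanti i.succ) (fun i => f i.succ) (fun i => hf _) (fun i => h0 i.succ)
      (fun i => h1 i.succ)
    apply hne
    have := hQ0 y (hanti 0 hy)
    rw [hev, h0 0 y hy, hQ] at this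
    simpa [Polynomial.eval_map, Polynomial.eval₂_at_zero, ← Polynomial.coeff_zero_eq_eval_zero] using this

theorem topologicalKrullDim_le (hF : IsZariski F) {d : ℕ} (h : AlgDependentOn F d Set.univ) :
    topologicalKrullDim Y ≤ d := by
  refine iSup_le fun l => ?_
  by_contra! hl
  have hlen : d + 1 ≤ l.length := by
    have : d < l.length := by exact_mod_cast hl
    exact this
  -- The bottom `d + 2` members of the chain, in decreasing order.
  let W : Fin (d + 2) → Set Y := fun i => l ⟨d + 1 - i, by omega⟩
  have hlt : ∀ i : Fin (d + 1), W i.succ ⊂ W i.castSucc := by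
    intro i
    refine l.strictMono (Fin.mk_lt_mk.2 ?_)
    simp only [Fin.val_succ, Fin.val_castSucc]
    omega
  have hsep : ∀ i : Fin (d + 1), ∃ f ∈ F, (∀ y ∈ W i.succ, f y = 0) ∧
      ∃ y ∈ W i.castSucc, f y ≠ 0 := by
    intro i
    obtain ⟨y, hy, hy'⟩ := Set.exists_of_ssubset (hlt i)
    obtain ⟨f, hf, hf0, hfy⟩ := hF.exists_separating (l ⟨d + 1 - i.succ, by omega⟩).isClosed' hy'
    exact ⟨f, hf, hf0, y, hy, hfy⟩
  choose f hf hf0 hf1 using hsep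
  obtain ⟨P, hP, hPf⟩ := h f hf
  obtain ⟨y, -, hy⟩ := hF.exists_eval_ne_zero_of_chain (d + 1) P hP W
    (fun i => (l ⟨d + 1 - i, by omega⟩).isIrreducible') (fun i => (hlt i).subset) f hf hf0 hf1
  exact hy (hPf y trivial)

theorem topologicalKrullDim_subtype_le (hF : IsZariski F) {d : ℕ} {S : Set Y}
    (h : AlgDependentOn F d S) : topologicalKrullDim S ≤ d := by
  refine (hF.pullback Topology.IsInducing.subtypeVal).topologicalKrullDim_le ?_
  have := h.preimage (Subtype.val : S → Y)
  rwa [Subtype.coe_preimage_self] at this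

theorem le_topologicalKrullDim (hF : IsZariski F) {n : ℕ} (W : Fin (n + 1) → Set Y)
    (hW : ∀ i, IsIrreducible (W i)) (hmono : ∀ i : Fin n, W i.castSucc ⊆ W i.succ)
    (h : ∀ i : Fin n, ∃ f ∈ F, (∀ y ∈ W i.castSucc, f y = 0) ∧ ∃ y ∈ W i.succ, f y ≠ 0) :
    (n : WithBot ℕ∞) ≤ topologicalKrullDim Y := by
  let l : LTSeries (TopologicalSpace.IrreducibleCloseds Y) :=
    { length := n
      toFun := fun i => ⟨closure (W i), (hW i).closure, isClosed_closure⟩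
      step := by
        intro i
        change closure (W i.castSucc) ⊂ closure (W i.succ)
        refine (Set.ssubset_iff_of_subset (closure_mono (hmono i))).2 ?_
        obtain ⟨f, hf, hf0, y, hy, hfy⟩ := h i
        exact ⟨y, subset_closure hy, fun hy' =>
          hfy (closure_minimal hf0 (hF.isClosed_zeros hf) hy')⟩ }
  exact Order.LTSeries.length_le_krullDim l

/-- A lower bound for the dimension from a flag of coordinate subspaces of an affine space mapping
polynomially to `Y`, whose images are separated by functions in `F`. -/
theorem le_topologicalKrullDim_of_masks (hF : IsZariski F) {σ : Type} (φ : (σ → ℂ) → Y)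
    (hφ : ∀ f ∈ F, ∃ P : MvPolynomial σ ℂ, ∀ z, f (φ z) = MvPolynomial.eval z P) {n : ℕ}
    (m : Fin (n + 1) → σ → ℂ) (hm : ∀ i : Fin n, m i.succ * m i.castSucc = m i.castSucc)
    (h : ∀ i : Fin n, ∃ f ∈ F, (∀ z, f (φ (m i.castSucc * z)) = 0) ∧
      ∃ z, f (φ (m i.succ * z)) ≠ 0) :
    (n : WithBot ℕ∞) ≤ topologicalKrullDim Y := by
  refine hF.le_topologicalKrullDim (fun i => Set.range fun z => φ (m i * z)) (fun i => ?_)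
    (fun i => ?_) (fun i => ?_)
  · refine hF.isIrreducible_range _ fun f hf => ?_
    obtain ⟨P, hP⟩ := hφ f hf
    refine ⟨MvPolynomial.aeval (fun j => MvPolynomial.C (m i j) * MvPolynomial.X j) P, fun z => ?_⟩
    rw [hP, eval_aeval]
    congr 2
    funext j
    simp
  · rintro _ ⟨z, rfl⟩
    exact ⟨m i.castSucc * z, by simp only [← mul_assoc, hm]⟩
  · obtain ⟨f, hf, hf0, z, hz⟩ := h i
    refine ⟨f, hf, ?_, _, ⟨z, rfl⟩, hz⟩
    rintro _ ⟨z, rfl⟩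
    exact hf0 z

end IsZariski

/-! ### Polynomial relations from transcendence degree -/

theorem exists_aeval_eq_zero_of_trdeg_lt {A : Type} [CommRing A] [Algebra ℂ A] {n d : ℕ}
    (hA : Algebra.trdeg ℂ A ≤ d) (hd : d < n) (F : Fin n → A) :
    ∃ P : MvPolynomial (Fin n) ℂ, P ≠ 0 ∧ MvPolynomial.aeval F P = 0 := by
  by_contra! hcon
  have hind : AlgebraicIndependent ℂ F :=
    (injective_iff_map_eq_zero _).2 fun P hP => by_contra fun h => hcon P h hP
  have h := hind.cardinalMk_le_trdeg.trans hA
  rw [Cardinal.mk_fin] at h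
  exact absurd (by exact_mod_cast h) (not_le.2 hd)

theorem trdeg_mvPolynomial_fin (n : ℕ) : Algebra.trdeg ℂ (MvPolynomial (Fin n) ℂ) ≤ n := by
  simp [MvPolynomial.trdeg_of_isDomain]

theorem trdeg_localization_le {A L : Type} [CommRing A] [IsDomain A] [Algebra ℂ A]
    [FaithfulSMul ℂ A] [CommRing L] [Algebra A L] [Algebra ℂ L] [IsScalarTower ℂ A L] [IsDomain L]
    (M : Submonoid A) [IsLocalization M L] (hM : M ≤ nonZeroDivisors A) :
    Algebra.trdeg ℂ L ≤ Algebra.trdeg ℂ A := by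
  have : FaithfulSMul A L := (faithfulSMul_iff_algebraMap_injective A L).2
    (IsLocalization.injective L hM)
  have : Algebra.IsAlgebraic A L := IsLocalization.isAlgebraic (R := A) (S := L) M
  have h := trdeg_add_eq ℂ A (A := L)
  rw [trdeg_eq_zero (R := A) (A := L), add_zero] at h
  exact h.ge

/-- Four Laurent polynomials in three variables (with `X 2`, `X 3` mutually inverse) satisfy a
polynomial relation. -/
theorem exists_eval_eq_zero_of_laurent (F : Fin 4 → MvPolynomial (Fin 4) ℂ) :
    ∃ P : MvPolynomial (Fin 4) ℂ, P ≠ 0 ∧ ∀ z : Fin 4 → ℂ, z 2 * z 3 = 1 →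
      MvPolynomial.eval (fun i => MvPolynomial.eval z (F i)) P = 0 := by
  -- `L` is `ℂ[X 0, X 1, X 2]` with `X 2` inverted, of transcendence degree at most 3. Every point
  -- with `z 2 * z 3 = 1` is an evaluation `L → ℂ`, so one relation in `L` serves all points.
  let A := MvPolynomial (Fin 3) ℂ
  let s : A := MvPolynomial.X 2
  let L := Localization.Away s
  have hs : s ≠ 0 := MvPolynomial.X_ne_zero _
  have hM : Submonoid.powers s ≤ nonZeroDivisors A := powers_le_nonZeroDivisors_of_noZeroDivisors hs
  have : IsDomain L := IsLocalization.isDomain_localization hM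
  let x : Fin 4 → L := ![algebraMap A L (MvPolynomial.X 0), algebraMap A L (MvPolynomial.X 1),
    algebraMap A L s, IsLocalization.Away.invSelf s]
  obtain ⟨P, hP, hP0⟩ := exists_aeval_eq_zero_of_trdeg_lt
    ((trdeg_localization_le (L := L) (Submonoid.powers s) hM).trans (trdeg_mvPolynomial_fin 3))
    (by norm_num) (fun i => MvPolynomial.aeval x (F i))
  refine ⟨P, hP, fun z hz => ?_⟩
  let e : A →ₐ[ℂ] ℂ := MvPolynomial.aeval ![z 0, z 1, z 2]
  have hes : e s = z 2 := by simp [e, s, A]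
  have hu : IsUnit (e s) := by
    rw [hes]
    exact IsUnit.of_mul_eq_one _ hz
  let φ : L →+* ℂ := IsLocalization.Away.lift s (g := e.toRingHom) hu
  have hφ : ∀ a, φ (algebraMap A L a) = e a := fun a => IsLocalization.Away.lift_eq s _ a
  let φ' : L →ₐ[ℂ] ℂ := { φ with
    commutes' := fun r => by
      change φ (algebraMap ℂ L r) = _
      rw [IsScalarTower.algebraMap_apply ℂ A L, hφ]
      simp }
  have hφ' : ∀ a, φ' (algebraMap A L a) = e a := hφ
  have hx : ∀ i, φ' (x i) = z i := by
    have h3 : φ' (IsLocalization.Away.invSelf s) = z 3 := by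
      have h := congrArg φ' (IsLocalization.Away.mul_invSelf (S := L) s)
      rw [map_mul, hφ', hes, map_one] at h
      have h2 : z 2 ≠ 0 := left_ne_zero_of_mul_eq_one hz
      exact mul_left_cancel₀ h2 (h.trans hz.symm)
    intro i
    fin_cases i
    · simp [x, hφ', e, A]
    · simp [x, hφ', e, A]
    · simpa [x, hφ'] using hes
    · simpa [x] using h3
  have h := congrArg φ' hP0
  rw [map_zero, MvPolynomial.comp_aeval_apply] at h
  rw [← h, MvPolynomial.aeval_eq_eval]
  congr 2
  funext i
  rw [MvPolynomial.comp_aeval_apply, MvPolynomial.aeval_eq_eval, funext hx]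

/-! ### Conjugates of triangular matrices -/

/-- The conjugate of the upper triangular matrix `!![α, x; 0, δ]` by `!![1, c; 0, 1] * !![1, 0; u, 1]`. -/
def conjUpper {R : Type} [CommRing R] (c u α x δ : R) : Matrix (Fin 2) (Fin 2) R :=
  !![α - u * x + c * (u * (α - u * x - δ)),
      x + c * (u * x + δ) - c * (α - u * x + c * (u * (α - u * x - δ)));
    u * (α - u * x - δ), u * x + δ - c * (u * (α - u * x - δ))]

section conjUpper

variable {R : Type} [CommRing R] (c u : R)

theorem conjUpper_map {S : Type} [CommRing S] (f : R →+* S) (α x δ : R) (i j : Fin 2) :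
    f (conjUpper c u α x δ i j) = conjUpper (f c) (f u) (f α) (f x) (f δ) i j := by
  fin_cases i <;> fin_cases j <;> simp [conjUpper]

theorem conjUpper_det (α x δ : R) : (conjUpper c u α x δ).det = α * δ := by
  rw [Matrix.det_fin_two]
  simp only [conjUpper, Matrix.of_apply, Matrix.cons_val]
  ring

theorem conjUpper_trace (α x δ : R) : (conjUpper c u α x δ).trace = α + δ := by
  rw [Matrix.trace_fin_two]
  simp only [conjUpper, Matrix.of_apply, Matrix.cons_val]
  ring

theorem conjUpper_scalar (α : R) : conjUpper c u α 0 α = α • (1 : Matrix (Fin 2) (Fin 2) R) := by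
  ext i j
  fin_cases i <;> fin_cases j <;> simp [conjUpper]

theorem conjUpper_mul (α x δ α' x' δ' : R) :
    conjUpper c u α x δ * conjUpper c u α' x' δ' =
      conjUpper c u (α * α') (α * x' + x * δ') (δ * δ') := by
  ext i j
  fin_cases i <;> fin_cases j <;>
    simp only [conjUpper, Matrix.mul_apply, Fin.sum_univ_two, Matrix.of_apply, Matrix.cons_val,
      Fin.zero_eta, Fin.mk_one] <;> ring

variable {c u}

theorem conjUpper_injective {α x δ α' x' δ' : R}
    (h : conjUpper c u α x δ = conjUpper c u α' x' δ') : α = α' ∧ x = x' ∧ δ = δ' := by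
  have h00 := congrFun (congrFun h 0) 0
  have h01 := congrFun (congrFun h 0) 1
  have h10 := congrFun (congrFun h 1) 0
  have h11 := congrFun (congrFun h 1) 1
  simp only [conjUpper, Matrix.of_apply, Matrix.cons_val] at h00 h01 h10 h11
  have hx : x = x' := by linear_combination h01 - c * h11 + c * (h00 - c * h10)
  subst hx
  refine ⟨by linear_combination h00 - c * h10, rfl, by linear_combination h11 + c * h10⟩

variable (c u)

/-- With corner `v * (δ - α)` the triangular matrix has second eigenvector `(v, 1)`, and taking
powers keeps it. -/
theorem conjUpper_diag_pow (α δ v : R) (n : ℕ) :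
    conjUpper c u α (v * (δ - α)) δ ^ n = conjUpper c u (α ^ n) (v * (δ ^ n - α ^ n)) (δ ^ n) := by
  induction n with
  | zero => simp [conjUpper_scalar]
  | succ n ih =>
    rw [pow_succ, ih, conjUpper_mul]
    congr 1 <;> ring

theorem conjUpper_unip_pow (α x : R) (n : ℕ) :
    conjUpper c u α x α ^ (n + 1) =
      conjUpper c u (α ^ (n + 1)) ((n + 1) * α ^ n * x) (α ^ (n + 1)) := by
  induction n with
  | zero => simp
  | succ n ih =>
    rw [pow_succ, ih, conjUpper_mul, ← pow_succ]
    congr 1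
    push_cast
    ring

end conjUpper

/-! ### Eigenvectors and commuting matrices -/

section Eigenvectors

open Matrix

/-- The conjugator sends the first basis vector to `(1 + c * u, u)`, so `c = 0` reaches every line
except the one spanned by `(0, 1)`, which `c = 1`, `u = -1` supplies. As `c` and `u` depend on `v`
only, matrices with a common eigenvector are triangularized together. -/
theorem exists_conjUpper_of_eigenvector {v : Fin 2 → ℂ} (hv : v ≠ 0) :
    ∃ c u : ℂ, (c = 0 ∨ c = 1) ∧ ∀ (A : Matrix (Fin 2) (Fin 2) ℂ) (l : ℂ), A.det = 1 →
      A *ᵥ v = l • v → l ≠ 0 ∧ ∃ x, A = conjUpper c u l x l⁻¹ := by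
  have hrow : ∀ (A : Matrix (Fin 2) (Fin 2) ℂ) (l : ℂ), A *ᵥ v = l • v →
      A 0 0 * v 0 + A 0 1 * v 1 = l * v 0 ∧ A 1 0 * v 0 + A 1 1 * v 1 = l * v 1 := by
    intro A l h
    have h0 := congrFun h 0
    have h1 := congrFun h 1
    simp only [Matrix.mulVec, dotProduct, Fin.sum_univ_two, Pi.smul_apply, smul_eq_mul] at h0 h1
    exact ⟨h0, h1⟩
  by_cases h0 : v 0 = 0
  · have h1 : v 1 ≠ 0 := fun h1 => hv (by ext i; fin_cases i <;> simp [h0, h1])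
    refine ⟨1, -1, Or.inr rfl, fun A l hA h => ?_⟩
    obtain ⟨e0, e1⟩ := hrow A l h
    rw [h0, mul_zero, zero_add, mul_zero] at e0
    rw [h0, mul_zero, zero_add] at e1
    have a01 : A 0 1 = 0 := (mul_eq_zero.1 e0).resolve_right h1
    have a11 : A 1 1 = l := mul_right_cancel₀ h1 e1
    rw [Matrix.det_fin_two, a01, a11, zero_mul, sub_zero] at hA
    have hl : l ≠ 0 := right_ne_zero_of_mul_eq_one hA
    have a00 : A 0 0 = l⁻¹ := eq_inv_of_mul_eq_one_left hA
    refine ⟨hl, -A 1 0 - l + l⁻¹, ?_⟩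
    rw [Matrix.eta_fin_two A, a00, a01, a11]
    ext i j
    fin_cases i <;> fin_cases j <;>
      simp only [conjUpper, Matrix.of_apply, Matrix.cons_val, Fin.zero_eta, Fin.mk_one] <;> ring
  · refine ⟨0, v 1 / v 0, Or.inl rfl, fun A l hA h => ?_⟩
    obtain ⟨e0, e1⟩ := hrow A l h
    set u := v 1 / v 0 with hu
    have hu' : v 1 = u * v 0 := by rw [hu]; field_simp
    rw [hu'] at e0 e1
    have a00 : A 0 0 = l - u * A 0 1 := mul_right_cancel₀ h0 (by linear_combination e0)
    have a10 : A 1 0 = u * (l - A 1 1) := mul_right_cancel₀ h0 (by linear_combination e1)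
    rw [Matrix.det_fin_two, a00, a10] at hA
    have h1 : l * (A 1 1 - u * A 0 1) = 1 := by linear_combination hA
    have hl : l ≠ 0 := left_ne_zero_of_mul_eq_one h1
    have a11 : A 1 1 = u * A 0 1 + l⁻¹ := by
      linear_combination eq_inv_of_mul_eq_one_right h1
    refine ⟨hl, A 0 1, ?_⟩
    rw [a11] at a10
    conv_lhs => rw [Matrix.eta_fin_two A, a00, a10, a11]
    ext i j
    fin_cases i <;> fin_cases j <;>
      simp only [conjUpper, Matrix.of_apply, Matrix.cons_val, Fin.zero_eta, Fin.mk_one] <;> ring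

theorem exists_eigenvector_of_trace {A : Matrix (Fin 2) (Fin 2) ℂ} (hA : A.det = 1) {l : ℂ}
    (hl : l ≠ 0) (h : A.trace = l + l⁻¹) : ∃ v ≠ 0, A *ᵥ v = l • v := by
  have hdet : (A - l • (1 : Matrix (Fin 2) (Fin 2) ℂ)).det = 0 := by
    rw [Matrix.det_fin_two] at hA ⊢
    rw [Matrix.trace_fin_two] at h
    simp only [Matrix.sub_apply, Matrix.smul_apply, smul_eq_mul, Matrix.one_apply_eq, ne_eq,
      zero_ne_one, one_ne_zero, not_false_eq_true, Matrix.one_apply_ne, mul_one, mul_zero, sub_zero]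
    have : l * l⁻¹ = 1 := mul_inv_cancel₀ hl
    linear_combination hA - l * h - this
  obtain ⟨v, hv, hv0⟩ := Matrix.exists_mulVec_eq_zero_iff.2 hdet
  refine ⟨v, hv, ?_⟩
  rwa [Matrix.sub_mulVec, Matrix.smul_mulVec, Matrix.one_mulVec, sub_eq_zero] at hv0

theorem exists_add_inv_eq (T : ℂ) : ∃ l : ℂ, l ≠ 0 ∧ T = l + l⁻¹ := by
  obtain ⟨s, hs⟩ := IsAlgClosed.exists_pow_nat_eq (T ^ 2 - 4) (n := 2) (by norm_num)
  have h : (T + s) / 2 * ((T - s) / 2) = 1 := by linear_combination (-1 / 4) * hs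
  refine ⟨(T + s) / 2, left_ne_zero_of_mul_eq_one h, ?_⟩
  rw [← eq_inv_of_mul_eq_one_right h]
  ring

theorem exists_eigenvector {A : Matrix (Fin 2) (Fin 2) ℂ} (hA : A.det = 1) :
    ∃ l : ℂ, ∃ v ≠ 0, A *ᵥ v = l • v := by
  obtain ⟨l, hl, h⟩ := exists_add_inv_eq A.trace
  exact ⟨l, exists_eigenvector_of_trace hA hl h⟩

/-- The matrices commuting with a nonscalar `2 × 2` matrix are its linear polynomials. -/
theorem exists_eq_smul_one_add_smul {A C : Matrix (Fin 2) (Fin 2) ℂ}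
    (hC : ∀ a : ℂ, C ≠ a • (1 : Matrix (Fin 2) (Fin 2) ℂ)) (h : A * C = C * A) :
    ∃ a b : ℂ, A = a • (1 : Matrix (Fin 2) (Fin 2) ℂ) + b • C := by
  have h00 := congrFun (congrFun h 0) 0
  have h01 := congrFun (congrFun h 0) 1
  have h10 := congrFun (congrFun h 1) 0
  simp only [Matrix.mul_apply, Fin.sum_univ_two] at h00 h01 h10
  suffices ∃ b, A 0 1 = b * C 0 1 ∧ A 1 0 = b * C 1 0 ∧ A 0 0 - A 1 1 = b * (C 0 0 - C 1 1) by
    obtain ⟨b, e1, e2, e3⟩ := this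
    refine ⟨A 0 0 - b * C 0 0, b, ?_⟩
    ext i j
    fin_cases i <;> fin_cases j <;> simp [e1, e2]
    linear_combination -e3
  by_cases c01 : C 0 1 = 0
  · by_cases c10 : C 1 0 = 0
    · by_cases cd : C 0 0 - C 1 1 = 0
      · refine (hC (C 0 0) ?_).elim
        ext i j
        fin_cases i <;> fin_cases j <;> simp [c01, c10]
        linear_combination -cd
      · refine ⟨(A 0 0 - A 1 1) / (C 0 0 - C 1 1), ?_, ?_, ?_⟩ <;> field_simp <;>
          first | linear_combination h01 | linear_combination -h01 | linear_combination h10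
    · refine ⟨A 1 0 / C 1 0, ?_, ?_, ?_⟩ <;> field_simp <;>
        first | linear_combination h00 | linear_combination -h00 | linear_combination -h10
  · refine ⟨A 0 1 / C 0 1, ?_, ?_, ?_⟩ <;> field_simp <;>
      first | linear_combination h00 | linear_combination -h00 | linear_combination h01

theorem commute_of_commute_nonscalar {A B C : Matrix (Fin 2) (Fin 2) ℂ}
    (hC : ∀ a : ℂ, C ≠ a • (1 : Matrix (Fin 2) (Fin 2) ℂ)) (hA : A * C = C * A)
    (hB : B * C = C * B) : A * B = B * A := by
  obtain ⟨a, b, rfl⟩ := exists_eq_smul_one_add_smul hC hA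
  simp only [add_mul, mul_add, smul_mul_assoc, mul_smul_comm, one_mul, mul_one, hB]

/-- Unless `A` is scalar, `B` is a linear polynomial in `A`, so any eigenvector of `A` serves. -/
theorem exists_common_eigenvector {A B : Matrix (Fin 2) (Fin 2) ℂ} (hA : A.det = 1)
    (hB : B.det = 1) (h : A * B = B * A) :
    ∃ l m : ℂ, ∃ v ≠ 0, A *ᵥ v = l • v ∧ B *ᵥ v = m • v := by
  by_cases hs : ∃ a : ℂ, A = a • (1 : Matrix (Fin 2) (Fin 2) ℂ)
  · obtain ⟨a, rfl⟩ := hs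
    obtain ⟨m, v, hv, hm⟩ := exists_eigenvector hB
    exact ⟨a, m, v, hv, by simp [Matrix.smul_mulVec], hm⟩
  · push Not at hs
    obtain ⟨a, b, rfl⟩ := exists_eq_smul_one_add_smul hs h.symm
    obtain ⟨l, v, hv, hl⟩ := exists_eigenvector hA
    refine ⟨l, a + b * l, v, hv, hl, ?_⟩
    simp [Matrix.add_mulVec, Matrix.smul_mulVec, hl, add_smul, smul_smul]

theorem pow_mulVec_eigenvector {A : Matrix (Fin 2) (Fin 2) ℂ} {v : Fin 2 → ℂ} {l : ℂ}
    (h : A *ᵥ v = l • v) (n : ℕ) : A ^ n *ᵥ v = l ^ n • v := by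
  induction n with
  | zero => simp
  | succ n ih => rw [pow_succ, ← Matrix.mulVec_mulVec, h, Matrix.mulVec_smul, ih, smul_smul, pow_succ']

/-- Squaring the eigenvalue relation absorbs the sign in `hpt`; the corner relation is what
commuting means for triangular matrices. -/
theorem exists_conjUpper_of_commute {A B : Matrix (Fin 2) (Fin 2) ℂ} (hA : A.det = 1)
    (hB : B.det = 1) (h : A * B = B * A) {p t : ℕ} (hpt : A ^ p = B ^ t ∨ A ^ p = -B ^ t) :
    ∃ c u l m x y : ℂ, (c = 0 ∨ c = 1) ∧ l ≠ 0 ∧ m ≠ 0 ∧ A = conjUpper c u l x l⁻¹ ∧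
      B = conjUpper c u m y m⁻¹ ∧ (l ^ p) ^ 2 = (m ^ t) ^ 2 ∧
      x * (m⁻¹ - m) = y * (l⁻¹ - l) := by
  obtain ⟨l, m, v, hv, hl, hm⟩ := exists_common_eigenvector hA hB h
  obtain ⟨c, u, hc, H⟩ := exists_conjUpper_of_eigenvector hv
  obtain ⟨hl0, x, hx⟩ := H A l hA hl
  obtain ⟨hm0, y, hy⟩ := H B m hB hm
  refine ⟨c, u, l, m, x, y, hc, hl0, hm0, hx, hy, ?_, ?_⟩
  · have h1 := pow_mulVec_eigenvector hl p
    have h2 := pow_mulVec_eigenvector hm t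
    have : l ^ p = m ^ t ∨ l ^ p = -m ^ t := by
      rcases hpt with hpt | hpt
      · rw [hpt, h2] at h1
        exact Or.inl (smul_left_injective ℂ hv h1).symm
      · rw [hpt, Matrix.neg_mulVec, h2, ← neg_smul] at h1
        exact Or.inr (smul_left_injective ℂ hv h1).symm
    rcases this with h | h <;> simp [h]
  · rw [hx, hy, conjUpper_mul, conjUpper_mul] at h
    linear_combination (conjUpper_injective h).2.1

end Eigenvectors

/-! ### Roots of unity and squared traces -/

/-- The `k`-th power of the standard primitive `p`-th root of unity. -/
noncomputable def unityPow (p k : ℕ) : ℂ := Complex.exp (2 * Real.pi * Complex.I / p) ^ k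

/-- The value of the squared trace on the elements of `PSL(2, ℂ)` whose eigenvalue ratio is
`unityPow p k`. -/
noncomputable def traceSqValue (p k : ℕ) : ℂ := unityPow p k + 2 + (unityPow p k)⁻¹

theorem unityPow_ne_zero (p k : ℕ) : unityPow p k ≠ 0 := pow_ne_zero _ (Complex.exp_ne_zero _)

theorem unityPow_pow {p : ℕ} (hp : 0 < p) (k : ℕ) : unityPow p k ^ p = 1 := by
  rw [unityPow, ← pow_mul, Nat.mul_comm k p, pow_mul, (Complex.isPrimitiveRoot_exp p hp.ne').pow_eq_one,
    one_pow]

theorem unityPow_eq_one_iff {p : ℕ} (hp : 0 < p) (k : ℕ) : unityPow p k = 1 ↔ p ∣ k :=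
  (Complex.isPrimitiveRoot_exp p hp.ne').pow_eq_one_iff_dvd k

theorem unityPow_ne_one {p k : ℕ} (hk : k ∈ Finset.Icc 1 (p / 2)) : unityPow p k ≠ 1 := by
  rw [Finset.mem_Icc] at hk
  intro h
  have := Nat.le_of_dvd (by omega) ((unityPow_eq_one_iff (by omega) k).1 h)
  omega

/-- `z + z⁻¹` determines `z` up to inversion, and `p ∣ k + l` with both at most `p / 2` forces `k =
l`. -/
theorem traceSqValue_injOn (p : ℕ) :
    Set.InjOn (traceSqValue p) (Finset.Icc 1 (p / 2) : Set ℕ) := by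
  intro k hk l hl h
  rw [Finset.mem_coe, Finset.mem_Icc] at hk hl
  have hp : 0 < p := by omega
  have hk0 := unityPow_ne_zero p k
  have hl0 := unityPow_ne_zero p l
  have h1 : (unityPow p k - unityPow p l) * (unityPow p k * unityPow p l - 1) = 0 := by
    unfold traceSqValue at h
    field_simp at h
    linear_combination h
  rcases mul_eq_zero.1 h1 with h1 | h1
  · exact (Complex.isPrimitiveRoot_exp p hp.ne').pow_inj (by omega) (by omega) (sub_eq_zero.1 h1)
  · rw [sub_eq_zero, unityPow, unityPow, ← pow_add] at h1
    have := Nat.le_of_dvd (by omega) ((unityPow_eq_one_iff hp (k + l)).1 h1)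
    omega

theorem add_inv_sq {l : ℂ} (hl : l ≠ 0) : (l + l⁻¹) ^ 2 = l ^ 2 + 2 + (l ^ 2)⁻¹ := by
  field_simp
  ring

theorem exists_traceSqValue_eq {p : ℕ} {A : Matrix (Fin 2) (Fin 2) ℂ} (hp : 0 < p)
    (hA : A.det = 1) (h : A ^ p = 1 ∨ A ^ p = -1)
    (hs : ∀ a : ℂ, A ≠ a • (1 : Matrix (Fin 2) (Fin 2) ℂ)) :
    ∃ k ∈ Finset.Icc 1 (p / 2), A.trace ^ 2 = traceSqValue p k := by
  obtain ⟨l, v, hv, hl⟩ := exists_eigenvector hA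
  obtain ⟨c, u, -, H⟩ := exists_conjUpper_of_eigenvector hv
  obtain ⟨hl0, x, hx⟩ := H A l hA hl
  obtain ⟨e, he, hAe⟩ : ∃ e : ℂ, e ^ 2 = 1 ∧ A ^ p = e • (1 : Matrix (Fin 2) (Fin 2) ℂ) := by
    rcases h with h | h
    · exact ⟨1, by norm_num, by simpa using h⟩
    · exact ⟨-1, by norm_num, by simpa using h⟩
  have hle : l ^ p = e := by
    have h1 := pow_mulVec_eigenvector hl p
    rw [hAe, Matrix.smul_mulVec, Matrix.one_mulVec] at h1
    exact (smul_left_injective ℂ hv h1).symm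
  -- Otherwise `A` is unipotent up to sign, and in characteristic zero the corner of its `p`-th
  -- power is a nonzero multiple of `x`; so `x = 0` and `A` is scalar.
  have hl1 : l ^ 2 ≠ 1 := by
    intro h2
    have hinv : l⁻¹ = l := inv_eq_of_mul_eq_one_left (by rw [← sq, h2])
    obtain ⟨n, rfl⟩ := Nat.exists_eq_succ_of_ne_zero hp.ne'
    rw [hinv] at hx
    rw [hx, Nat.succ_eq_add_one, conjUpper_unip_pow, ← conjUpper_scalar c u] at hAe
    have hx0 := (conjUpper_injective hAe).2.1
    have hn : ((n : ℂ) + 1) * l ^ n ≠ 0 := mul_ne_zero (Nat.cast_add_one_ne_zero n) (pow_ne_zero n hl0)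
    have := (mul_eq_zero.1 hx0).resolve_left hn
    rw [this, conjUpper_scalar] at hx
    exact hs l hx
  have hlp : (l ^ 2) ^ p = 1 := by rw [← pow_mul, mul_comm, pow_mul, hle, he]
  have : NeZero p := ⟨hp.ne'⟩
  obtain ⟨m, hm, hml⟩ := (Complex.isPrimitiveRoot_exp p hp.ne').eq_pow_of_pow_eq_one hlp
  change unityPow p m = l ^ 2 at hml
  have hm0 : m ≠ 0 := by
    rintro rfl
    exact hl1 (hml.symm.trans (pow_zero _))
  have htr : A.trace ^ 2 = traceSqValue p m := by
    rw [hx, conjUpper_trace, add_inv_sq hl0, ← hml, traceSqValue]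
  by_cases hmp : m ≤ p / 2
  · exact ⟨m, Finset.mem_Icc.2 ⟨by omega, hmp⟩, htr⟩
  -- Replace the root of unity by its inverse, which has the same squared trace.
  · refine ⟨p - m, Finset.mem_Icc.2 ⟨by omega, by omega⟩, ?_⟩
    have hinv : unityPow p (p - m) = (unityPow p m)⁻¹ := by
      refine eq_inv_of_mul_eq_one_left ?_
      rw [unityPow, unityPow, ← pow_add, Nat.sub_add_cancel hm.le]
      exact (unityPow_eq_one_iff hp p).2 dvd_rfl
    rw [htr, traceSqValue, traceSqValue, hinv, inv_inv]
    ring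

section SquareRoot

variable {p k : ℕ} {l : ℂ}

theorem ne_zero_of_sq_eq_unityPow (hl : l ^ 2 = unityPow p k) : l ≠ 0 := by
  rintro rfl
  exact unityPow_ne_zero p k (by simpa using hl.symm)

theorem inv_sub_ne_zero_of_sq_eq_unityPow (hk : k ∈ Finset.Icc 1 (p / 2))
    (hl : l ^ 2 = unityPow p k) : l⁻¹ - l ≠ 0 := by
  intro h
  apply unityPow_ne_one hk
  rw [← hl, sq]
  nth_rewrite 1 [← sub_eq_zero.1 h]
  exact inv_mul_cancel₀ (ne_zero_of_sq_eq_unityPow hl)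

theorem exists_conjUpper_of_trace {A : Matrix (Fin 2) (Fin 2) ℂ} (hA : A.det = 1)
    (hk : k ∈ Finset.Icc 1 (p / 2)) (hl : l ^ 2 = unityPow p k) (htr : A.trace = l + l⁻¹) :
    ∃ c u v : ℂ, (c = 0 ∨ c = 1) ∧ A = conjUpper c u l (v * (l⁻¹ - l)) l⁻¹ := by
  obtain ⟨v, hv, hlv⟩ := exists_eigenvector_of_trace hA (ne_zero_of_sq_eq_unityPow hl) htr
  obtain ⟨c, u, hc, H⟩ := exists_conjUpper_of_eigenvector hv
  obtain ⟨-, x, hx⟩ := H A l hA hlv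
  refine ⟨c, u, x / (l⁻¹ - l), hc, ?_⟩
  rwa [div_mul_cancel₀ _ (inv_sub_ne_zero_of_sq_eq_unityPow hk hl)]

/-- Here `l ^ p = ± 1` equals its own inverse, so the corner of the power vanishes and the power is
scalar. -/
theorem conjUpper_pow_of_sq_eq_unityPow (hp : 0 < p) (hl : l ^ 2 = unityPow p k) (c u v : ℂ) :
    conjUpper c u l (v * (l⁻¹ - l)) l⁻¹ ^ p = 1 ∨ conjUpper c u l (v * (l⁻¹ - l)) l⁻¹ ^ p = -1 := by
  have h2 : (l ^ p) ^ 2 = 1 := by rw [← pow_mul, mul_comm, pow_mul, hl, unityPow_pow hp]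
  have hinv : l⁻¹ ^ p = l ^ p := by
    rw [inv_pow]
    exact inv_eq_of_mul_eq_one_left (by rw [← sq, h2])
  rw [conjUpper_diag_pow, hinv, sub_self, mul_zero, conjUpper_scalar]
  rcases mul_self_eq_one_iff.1 ((sq _).symm.trans h2) with h | h <;> simp [h]

end SquareRoot

/-! ### Lifts from `PSL(2, ℂ)` to `SL(2, ℂ)` and regular functions -/

section

open Matrix

theorem specialLinearGroup_mk_eq_iff (a b : SpecialLinearGroup (Fin 2) ℂ) :
    (QuotientGroup.mk a : PSL2C) = QuotientGroup.mk b ↔ a.1 = b.1 ∨ a.1 = -b.1 := by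
  rw [eq_comm, QuotientGroup.eq, Matrix.SpecialLinearGroup.mem_center_iff]
  constructor
  · rintro ⟨r, hr, h⟩
    have hab : a.1 = r • b.1 := by
      have h2 : a = b * (b⁻¹ * a) := by group
      rw [h2, Matrix.SpecialLinearGroup.coe_mul, ← h]
      simp [← Matrix.smul_one_eq_diagonal]
    rw [Fintype.card_fin] at hr
    rcases mul_self_eq_one_iff.1 ((sq _).symm.trans hr) with h | h
    · left; simpa [h] using hab
    · right; simpa [h] using hab
  · rintro (h | h)
    · have : a = b := Subtype.ext h
      exact ⟨1, by simp, by simp [this]⟩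
    · have : a = -b := Subtype.ext (by simpa using h)
      refine ⟨-1, by simp, ?_⟩
      rw [this]
      simp [← Matrix.smul_one_eq_diagonal]

theorem projPow_eq_iff {n : ℕ} (g h : Fin n → SpecialLinearGroup (Fin 2) ℂ) :
    projPow n g = projPow n h ↔ ∀ i, (g i).1 = (h i).1 ∨ (g i).1 = -(h i).1 := by
  exact funext_iff.trans <| forall_congr' fun i => specialLinearGroup_mk_eq_iff _ _

theorem projPow_surjective (n : ℕ) : Function.Surjective (projPow n) := by
  intro q
  choose g hg using fun i => QuotientGroup.mk_surjective (q i)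
  exact ⟨g, funext hg⟩

/-- The matrix entries of a tuple. -/
def entries {n : ℕ} (g : Fin n → SpecialLinearGroup (Fin 2) ℂ) : Fin n × Fin 2 × Fin 2 → ℂ :=
  fun k => (g k.1).1 k.2.1 k.2.2

section RepVariety

variable {G : Type} [Group G] {n : ℕ} (s : Fin n → G)

/-- The regular functions on the representation variety. -/
def repFunctions : Subalgebra ℂ (RepVariety s → ℂ) :=
  (regularFunctions n).map (pullbackAlgHom (RepVariety.toPow s))

theorem isZariski_repFunctions : IsZariski (repFunctions s) :=
  IsZariski.pullback (IsZariski.of_zariskiTopology (regularFunctions n)) ⟨rfl⟩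

variable {s}

theorem exists_lift (ρ : RepVariety s) :
    ∃ g : Fin n → SpecialLinearGroup (Fin 2) ℂ, RepVariety.toPow s ρ = projPow n g := by
  obtain ⟨g, hg⟩ := projPow_surjective n (RepVariety.toPow s ρ)
  exact ⟨g, hg.symm⟩

theorem exists_eval_entries {f : RepVariety s → ℂ} (hf : f ∈ repFunctions s) :
    ∃ P : MvPolynomial (Fin n × Fin 2 × Fin 2) ℂ, ∀ ρ g, RepVariety.toPow s ρ = projPow n g →
      f ρ = MvPolynomial.eval (entries g) P := by
  obtain ⟨f', ⟨P, hP⟩, rfl⟩ := hf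
  refine ⟨P, fun ρ g h => ?_⟩
  exact (congrArg f' h).trans (hP g)

/-- A polynomial in the entries descends once it is unchanged by independent sign changes of the
lifts. -/
theorem exists_repFunction (P : MvPolynomial (Fin n × Fin 2 × Fin 2) ℂ)
    (hP : ∀ g g' : Fin n → SpecialLinearGroup (Fin 2) ℂ,
      (∀ i, (g i).1 = (g' i).1 ∨ (g i).1 = -(g' i).1) →
        MvPolynomial.eval (entries g) P = MvPolynomial.eval (entries g') P) :
    ∃ f ∈ repFunctions s, ∀ ρ g, RepVariety.toPow s ρ = projPow n g →
      f ρ = MvPolynomial.eval (entries g) P := by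
  choose lift hlift using projPow_surjective n
  have key : ∀ g, MvPolynomial.eval (entries (lift (projPow n g))) P =
      MvPolynomial.eval (entries g) P := fun g => hP _ _ ((projPow_eq_iff _ _).1 (hlift _))
  refine ⟨_, ⟨fun q => MvPolynomial.eval (entries (lift q)) P, ⟨P, key⟩, rfl⟩, fun ρ g h => ?_⟩
  rw [← key g, ← h]
  rfl

end RepVariety

section Charts

variable {G : Type} [Group G] (s : Fin 2 → G) {σ : Type} (c u α x δ : Fin 2 → MvPolynomial σ ℂ)

/-- The pair of matrices `conjUpper` whose parameters are polynomials in `z`. -/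
noncomputable def chartMatrix (z : σ → ℂ) (i : Fin 2) : Matrix (Fin 2) (Fin 2) ℂ :=
  conjUpper (MvPolynomial.eval z (c i)) (MvPolynomial.eval z (u i)) (MvPolynomial.eval z (α i))
    (MvPolynomial.eval z (x i)) (MvPolynomial.eval z (δ i))

/-- The representations with a lift of the form `chartMatrix z` for some `z ∈ D`. -/
def chartSet (D : Set (σ → ℂ)) : Set (RepVariety s) :=
  {ρ | ∃ z ∈ D, ∃ g, RepVariety.toPow s ρ = projPow 2 g ∧
    ∀ i, (g i).1 = chartMatrix c u α x δ z i}

variable {s}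

theorem exists_eval_chart {f : RepVariety s → ℂ} (hf : f ∈ repFunctions s) :
    ∃ Q : MvPolynomial σ ℂ, ∀ z ρ g, RepVariety.toPow s ρ = projPow 2 g →
      (∀ i, (g i).1 = chartMatrix c u α x δ z i) → f ρ = MvPolynomial.eval z Q := by
  obtain ⟨P, hP⟩ := exists_eval_entries hf
  refine ⟨MvPolynomial.aeval (fun k : Fin 2 × Fin 2 × Fin 2 =>
    conjUpper (c k.1) (u k.1) (α k.1) (x k.1) (δ k.1) k.2.1 k.2.2) P, fun z ρ g h hg => ?_⟩
  rw [hP ρ g h, eval_aeval]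
  congr 2
  funext k
  rw [conjUpper_map, entries, hg]
  rfl

theorem algDependentOn_chartSet {d : ℕ} (c u α x δ : Fin 2 → MvPolynomial (Fin d) ℂ) :
    AlgDependentOn (repFunctions s) d (chartSet s c u α x δ Set.univ) := by
  intro f hf
  choose Q hQ using fun i => exists_eval_chart c u α x δ (hf i)
  obtain ⟨P, hP, hPQ⟩ := exists_aeval_eq_zero_of_trdeg_lt (trdeg_mvPolynomial_fin d)
    (Nat.lt_succ_self d) Q
  refine ⟨P, hP, ?_⟩
  rintro ρ ⟨z, -, g, h, hg⟩
  rw [funext fun i => hQ i z ρ g h hg, ← eval_aeval, hPQ, map_zero]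

theorem algDependentOn_chartSet_laurent (c u α x δ : Fin 2 → MvPolynomial (Fin 4) ℂ) :
    AlgDependentOn (repFunctions s) 3 (chartSet s c u α x δ {z | z 2 * z 3 = 1}) := by
  intro f hf
  choose Q hQ using fun i => exists_eval_chart c u α x δ (hf i)
  obtain ⟨P, hP, hPQ⟩ := exists_eval_eq_zero_of_laurent Q
  refine ⟨P, hP, ?_⟩
  rintro ρ ⟨z, hz, g, h, hg⟩
  rw [funext fun i => hQ i z ρ g h hg, hPQ z hz]

end Charts

/-! ### Representations of the torus group and the closed cover -/

section TorusGroup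

variable {p t : ℕ}

theorem toPow_injective : Function.Injective (RepVariety.toPow (torusGroupGen p t)) := by
  intro ρ ρ' h
  refine PresentedGroup.ext fun i => ?_
  exact congrFun h i

theorem exists_rep {g : Fin 2 → SpecialLinearGroup (Fin 2) ℂ}
    (hg : (g 0).1 ^ p = (g 1).1 ^ t ∨ (g 0).1 ^ p = -(g 1).1 ^ t) :
    ∃ ρ : RepVariety (torusGroupGen p t), RepVariety.toPow _ ρ = projPow 2 g := by
  have hrel : ∀ r ∈ ({FreeGroup.of 0 ^ p * (FreeGroup.of 1 ^ t)⁻¹} : Set (FreeGroup (Fin 2))),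
      FreeGroup.lift (fun i => (QuotientGroup.mk (g i) : PSL2C)) r = 1 := by
    rintro r rfl
    have : (QuotientGroup.mk (g 0 ^ p) : PSL2C) = QuotientGroup.mk (g 1 ^ t) :=
      (specialLinearGroup_mk_eq_iff _ _).2 (by simpa using hg)
    rw [map_mul, map_inv, map_pow, map_pow, FreeGroup.lift_apply_of, FreeGroup.lift_apply_of,
      mul_inv_eq_one]
    exact this
  refine ⟨PresentedGroup.toGroup hrel, funext fun i => ?_⟩
  exact PresentedGroup.toGroup.of hrel

theorem pow_eq_or_eq_neg {ρ : RepVariety (torusGroupGen p t)}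
    {g : Fin 2 → SpecialLinearGroup (Fin 2) ℂ} (h : RepVariety.toPow _ ρ = projPow 2 g) :
    (g 0).1 ^ p = (g 1).1 ^ t ∨ (g 0).1 ^ p = -(g 1).1 ^ t := by
  have hgen : torusGroupGen p t 0 ^ p = torusGroupGen p t 1 ^ t := by
    have h1 := PresentedGroup.one_of_mem (rels := {FreeGroup.of 0 ^ p * (FreeGroup.of 1 ^ t)⁻¹})
      (Set.mem_singleton (FreeGroup.of (0 : Fin 2) ^ p * (FreeGroup.of 1 ^ t)⁻¹))
    rw [map_mul, map_inv, map_pow, map_pow, mul_inv_eq_one] at h1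
    exact h1
  have h2 : (QuotientGroup.mk (g 0 ^ p) : PSL2C) = QuotientGroup.mk (g 1 ^ t) := by
    change projPow 2 g 0 ^ p = projPow 2 g 1 ^ t
    rw [← h]
    have := congrArg (show torusGroup p t →* PSL2C from ρ) hgen
    exact (map_pow _ _ _).symm.trans (this.trans (map_pow _ _ _))
  simpa using (specialLinearGroup_mk_eq_iff _ _).1 h2

end TorusGroup

section TorusGroup

variable {p t : ℕ}

/-- The representations of the torus group whose generators have commuting lifts. -/
def commutingReps (p t : ℕ) : Set (RepVariety (torusGroupGen p t)) :=
  {ρ | ∀ g, RepVariety.toPow _ ρ = projPow 2 g → (g 0).1 * (g 1).1 = (g 1).1 * (g 0).1}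

/-- The representations sending the generators to elements with the squared traces
`traceSqValue p (K 0)` and `traceSqValue t (K 1)`. -/
def traceReps (p t : ℕ) (K : Fin 2 → ℕ) : Set (RepVariety (torusGroupGen p t)) :=
  {ρ | ∀ g, RepVariety.toPow _ ρ = projPow 2 g →
    ∀ i, (g i).1.trace ^ 2 = traceSqValue (![p, t] i) (K i)}

theorem mem_commutingReps_iff {ρ : RepVariety (torusGroupGen p t)}
    {g : Fin 2 → SpecialLinearGroup (Fin 2) ℂ} (h : RepVariety.toPow _ ρ = projPow 2 g) :
    ρ ∈ commutingReps p t ↔ (g 0).1 * (g 1).1 = (g 1).1 * (g 0).1 := by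
  refine ⟨fun hρ => hρ g h, fun hg g' h' => ?_⟩
  have hs := (projPow_eq_iff g' g).1 (h'.symm.trans h)
  rcases hs 0 with h0 | h0 <;> rcases hs 1 with h1 | h1 <;> rw [h0, h1] <;> simp [hg]

theorem mem_traceReps_iff {K : Fin 2 → ℕ} {ρ : RepVariety (torusGroupGen p t)}
    {g : Fin 2 → SpecialLinearGroup (Fin 2) ℂ} (h : RepVariety.toPow _ ρ = projPow 2 g) :
    ρ ∈ traceReps p t K ↔ ∀ i, (g i).1.trace ^ 2 = traceSqValue (![p, t] i) (K i) := by
  refine ⟨fun hρ => hρ g h, fun hg g' h' i => ?_⟩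
  rw [← hg i]
  rcases (projPow_eq_iff g' g).1 (h'.symm.trans h) i with h0 | h0 <;>
    simp [h0]

theorem isClosed_of_entries (P : MvPolynomial (Fin 2 × Fin 2 × Fin 2) ℂ)
    (hP : ∀ g g' : Fin 2 → SpecialLinearGroup (Fin 2) ℂ,
      (∀ i, (g i).1 = (g' i).1 ∨ (g i).1 = -(g' i).1) →
        MvPolynomial.eval (entries g) P = MvPolynomial.eval (entries g') P) :
    IsClosed {ρ : RepVariety (torusGroupGen p t) | ∀ g, RepVariety.toPow _ ρ = projPow 2 g →
      MvPolynomial.eval (entries g) P = 0} := by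
  obtain ⟨f, hf, h⟩ := exists_repFunction (s := torusGroupGen p t) P hP
  convert (isZariski_repFunctions (torusGroupGen p t)).isClosed_zeros hf using 1
  ext ρ
  constructor
  · intro hρ
    obtain ⟨g, hg⟩ := exists_lift ρ
    exact (h ρ g hg).trans (hρ g hg)
  · intro hρ g hg
    exact (h ρ g hg).symm.trans hρ

theorem isClosed_commutingReps : IsClosed (commutingReps p t) := by
  let X : Fin 2 → Fin 2 → Fin 2 → MvPolynomial (Fin 2 × Fin 2 × Fin 2) ℂ :=
    fun i a b => MvPolynomial.X (i, a, b)
  let P : Fin 2 → Fin 2 → MvPolynomial (Fin 2 × Fin 2 × Fin 2) ℂ := fun a b =>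
    -- The commutator entries change sign with the lift; their squares do not.
    (∑ j, X 0 a j * X 1 j b - ∑ j, X 1 a j * X 0 j b) ^ 2
  have hP : ∀ a b (g : Fin 2 → SpecialLinearGroup (Fin 2) ℂ),
      MvPolynomial.eval (entries g) (P a b) =
        (((g 0).1 * (g 1).1) a b - ((g 1).1 * (g 0).1) a b) ^ 2 := by
    intro a b g
    simp [P, X, entries, Matrix.mul_apply]
  have hclosed := isClosed_iInter fun a => isClosed_iInter fun b =>
    isClosed_of_entries (p := p) (t := t) (P a b) fun g g' hs => by
      rw [hP, hP]
      rcases hs 0 with h0 | h0 <;> rcases hs 1 with h1 | h1 <;> rw [h0, h1] <;>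
        simp only [neg_mul, mul_neg, neg_neg, Matrix.neg_apply] <;> ring
  convert hclosed using 1
  ext ρ
  simp only [Set.mem_iInter, Set.mem_ofPred_eq, hP]
  constructor
  · intro h a b g hg
    rw [h g hg, sub_self]
    norm_num
  · intro h g hg
    ext a b
    exact sub_eq_zero.1 (pow_eq_zero_iff two_ne_zero |>.1 (h a b g hg))

theorem isClosed_traceReps (K : Fin 2 → ℕ) : IsClosed (traceReps p t K) := by
  let P : Fin 2 → MvPolynomial (Fin 2 × Fin 2 × Fin 2) ℂ := fun i =>
    (MvPolynomial.X (i, 0, 0) + MvPolynomial.X (i, 1, 1)) ^ 2 -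
      MvPolynomial.C (traceSqValue (![p, t] i) (K i))
  have hP : ∀ i (g : Fin 2 → SpecialLinearGroup (Fin 2) ℂ), MvPolynomial.eval (entries g) (P i) =
      (g i).1.trace ^ 2 - traceSqValue (![p, t] i) (K i) := by
    intro i g
    simp [P, entries, Matrix.trace_fin_two]
  have hclosed := isClosed_iInter fun i =>
    isClosed_of_entries (p := p) (t := t) (P i) fun g g' hs => by
      rw [hP, hP]
      rcases hs i with h0 | h0 <;> simp [h0]
  convert hclosed using 1
  ext ρ
  simp only [Set.mem_iInter, Set.mem_ofPred_eq, hP, sub_eq_zero]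
  exact ⟨fun h i g hg => h g hg i, fun h g hg i => h i g hg⟩

theorem eq_of_mem_traceReps {K K' : Fin 2 → ℕ} (hK : ∀ i : Fin 2, K i ∈ Finset.Icc 1 (![p, t] i / 2))
    (hK' : ∀ i : Fin 2, K' i ∈ Finset.Icc 1 (![p, t] i / 2)) {ρ : RepVariety (torusGroupGen p t)}
    (h : ρ ∈ traceReps p t K) (h' : ρ ∈ traceReps p t K') : K = K' := by
  obtain ⟨g, hg⟩ := exists_lift ρ
  funext i
  exact traceSqValue_injOn (![p, t] i) (Finset.mem_coe.2 (hK i)) (Finset.mem_coe.2 (hK' i))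
    ((h g hg i).symm.trans (h' g hg i))

theorem mem_commutingReps_or_traceReps (hp : 0 < p) (ht : 0 < t)
    (ρ : RepVariety (torusGroupGen p t)) :
    ρ ∈ commutingReps p t ∨
      ∃ K, (∀ i : Fin 2, K i ∈ Finset.Icc 1 (![p, t] i / 2)) ∧ ρ ∈ traceReps p t K := by
  obtain ⟨g, hg⟩ := exists_lift ρ
  have hpt := pow_eq_or_eq_neg hg
  rw [mem_commutingReps_iff hg, or_iff_not_imp_left]
  intro hcomm
  have hA : ∀ a : ℂ, (g 0).1 ≠ a • (1 : Matrix (Fin 2) (Fin 2) ℂ) := fun a h =>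
    hcomm (by rw [h]; simp)
  have hB : ∀ a : ℂ, (g 1).1 ≠ a • (1 : Matrix (Fin 2) (Fin 2) ℂ) := fun a h =>
    hcomm (by rw [h]; simp)
  -- If this power were nonscalar, both generators would commute with it and hence with each other.
  have hC : ∃ a : ℂ, (g 0).1 ^ p = a • (1 : Matrix (Fin 2) (Fin 2) ℂ) := by
    by_contra! hC
    refine hcomm (commute_of_commute_nonscalar hC (pow_mul_comm' _ _).symm ?_)
    rcases hpt with h | h <;> rw [h]
    · exact (pow_mul_comm' _ _).symm
    · rw [mul_neg, neg_mul, pow_mul_comm']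
  obtain ⟨a, ha⟩ := hC
  have ha2 : a * a = 1 := by
    have := congrArg Matrix.det ha
    rw [Matrix.det_pow, (g 0).2, one_pow, Matrix.det_smul, Matrix.det_one, Fintype.card_fin] at this
    linear_combination -this
  have h0 : (g 0).1 ^ p = 1 ∨ (g 0).1 ^ p = -1 := by
    rcases mul_self_eq_one_iff.1 ha2 with h | h
    · exact Or.inl (by rw [ha, h, one_smul])
    · exact Or.inr (by rw [ha, h, neg_smul, one_smul])
  have h1 : (g 1).1 ^ t = 1 ∨ (g 1).1 ^ t = -1 := by
    rcases hpt with h | h <;> rw [h] at h0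
    · exact h0
    · rcases h0 with h0 | h0
      · exact Or.inr (by rw [← h0, neg_neg])
      · exact Or.inl (neg_injective h0)
  obtain ⟨k, hk, hk'⟩ := exists_traceSqValue_eq hp (g 0).2 h0 hA
  obtain ⟨l, hl, hl'⟩ := exists_traceSqValue_eq ht (g 1).2 h1 hB
  refine ⟨![k, l], ?_, (mem_traceReps_iff hg).2 ?_⟩
  · intro i
    fin_cases i
    · exact hk
    · exact hl
  · intro i
    fin_cases i
    · exact hk'
    · exact hl'

end TorusGroup

/-! ### The commuting locus has dimension at most 3 -/

section CommutingDimension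

variable {p t : ℕ}

/-- The representations whose lifts are simultaneously diagonalizable, with eigenvalues `s ^ t` and
`ζ * s ^ p`; the parameter `c` selects an affine chart for the eigenline. -/
def diagonalizableChart (p t : ℕ) (c ζ : ℂ) : Set (RepVariety (torusGroupGen p t)) :=
  chartSet (σ := Fin 4) _ (fun _ => MvPolynomial.C c) (fun _ => MvPolynomial.X 0)
    ![MvPolynomial.X 2 ^ t, MvPolynomial.C ζ * MvPolynomial.X 2 ^ p]
    ![MvPolynomial.X 1 * (MvPolynomial.X 3 ^ t - MvPolynomial.X 2 ^ t),
      MvPolynomial.X 1 * (MvPolynomial.C ζ⁻¹ * MvPolynomial.X 3 ^ p -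
        MvPolynomial.C ζ * MvPolynomial.X 2 ^ p)]
    ![MvPolynomial.X 3 ^ t, MvPolynomial.C ζ⁻¹ * MvPolynomial.X 3 ^ p] {z | z 2 * z 3 = 1}

/-- The representations with lifts that are unipotent up to the signs `e`, with a common
eigenline in the affine chart given by `c`. -/
def unipotentChart (p t : ℕ) (c : ℂ) (e : Fin 2 → ℂ) : Set (RepVariety (torusGroupGen p t)) :=
  chartSet (σ := Fin 3) _ (fun _ => MvPolynomial.C c) (fun _ => MvPolynomial.X 0)
    (fun i => MvPolynomial.C (e i)) ![MvPolynomial.X 1, MvPolynomial.X 2]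
    (fun i => MvPolynomial.C (e i)) Set.univ

/-- Choose `s` with `s ^ t = l`. Then `(l ^ p) ^ 2 = (m ^ t) ^ 2` makes `m / s ^ p` a `2 * t`-th
root of unity, leaving finitely many families in the parameters `u`, `v`, `s`. The case where both
eigenvalues are `± 1` is separate, with parameters `u`, `x`, `y`. -/
theorem commutingReps_subset (ht : 0 < t) :
    commutingReps p t ⊆
      (⋃ q ∈ ({0, 1} : Finset ℂ) ×ˢ (Polynomial.nthRoots (2 * t) (1 : ℂ)).toFinset,
        diagonalizableChart p t q.1 q.2) ∪
      ⋃ q ∈ ({0, 1} : Finset ℂ) ×ˢ Fintype.piFinset fun _ : Fin 2 => ({1, -1} : Finset ℂ),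
        unipotentChart p t q.1 q.2 := by
  intro ρ hρ
  obtain ⟨g, hg⟩ := exists_lift ρ
  obtain ⟨c, u, l, m, x, y, hc, hl, hm, hA, hB, hlm, hxy⟩ :=
    exists_conjUpper_of_commute (g 0).2 (g 1).2 (hρ g hg) (pow_eq_or_eq_neg hg)
  have hc' : c ∈ ({0, 1} : Finset ℂ) := by simpa using hc
  by_cases hunip : l⁻¹ = l ∧ m⁻¹ = m
  · right
    have hl1 : l = 1 ∨ l = -1 := mul_self_eq_one_iff.1 (by
      nth_rewrite 1 [← hunip.1]; exact inv_mul_cancel₀ hl)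
    have hm1 : m = 1 ∨ m = -1 := mul_self_eq_one_iff.1 (by
      nth_rewrite 1 [← hunip.2]; exact inv_mul_cancel₀ hm)
    rw [hunip.1] at hA
    rw [hunip.2] at hB
    refine Set.mem_biUnion (x := (c, ![l, m])) ?_ ⟨![u, x, y], trivial, g, hg, ?_⟩
    · refine Finset.mem_coe.2 (Finset.mem_product.2 ⟨hc', Fintype.mem_piFinset.2 fun i => ?_⟩)
      fin_cases i
      · simpa using hl1
      · simpa using hm1
    · intro i
      fin_cases i
      · simpa [chartMatrix] using hA
      · simpa [chartMatrix] using hB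
  · left
    -- At least one eigenvalue difference is nonzero; it defines the second eigenline, and `hxy`
    -- shows that the other matrix shares it.
    obtain ⟨v, hvx, hvy⟩ : ∃ v, x = v * (l⁻¹ - l) ∧ y = v * (m⁻¹ - m) := by
      by_cases h : l⁻¹ - l = 0
      · have hm' : m⁻¹ - m ≠ 0 := fun h' => hunip ⟨sub_eq_zero.1 h, sub_eq_zero.1 h'⟩
        refine ⟨y / (m⁻¹ - m), mul_right_cancel₀ hm' ?_, (div_mul_cancel₀ _ hm').symm⟩
        rw [hxy, h]
        ring
      · refine ⟨x / (l⁻¹ - l), (div_mul_cancel₀ _ h).symm, mul_right_cancel₀ h ?_⟩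
        rw [← hxy, mul_right_comm, div_mul_cancel₀ _ h]
    obtain ⟨s, hs⟩ := IsAlgClosed.exists_pow_nat_eq l ht
    have hs0 : s ≠ 0 := by
      rintro rfl
      exact hl (by rw [← hs, zero_pow ht.ne'])
    have hζ : m / s ^ p * s ^ p = m := div_mul_cancel₀ _ (pow_ne_zero p hs0)
    have hζ' : (m / s ^ p)⁻¹ * s⁻¹ ^ p = m⁻¹ := by rw [inv_pow, ← mul_inv, hζ]
    have hs' : s⁻¹ ^ t = l⁻¹ := by rw [inv_pow, hs]
    have hmul : s * s⁻¹ = 1 := mul_inv_cancel₀ hs0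
    refine Set.mem_biUnion (x := (c, m / s ^ p)) ?_ ⟨![u, v, s, s⁻¹], hmul, g, hg, ?_⟩
    · refine Finset.mem_coe.2 (Finset.mem_product.2 ⟨hc', ?_⟩)
      rw [Multiset.mem_toFinset, Polynomial.mem_nthRoots (by omega), div_pow,
        div_eq_one_iff_eq (pow_ne_zero _ (pow_ne_zero p hs0))]
      rw [mul_comm 2 t, pow_mul, ← hlm, ← hs]
      ring
    · intro i
      fin_cases i
      · simp only [chartMatrix, Fin.zero_eta, MvPolynomial.eval_C, MvPolynomial.eval_X,
          Matrix.cons_val, map_pow, map_mul, map_sub, hs, hs', ← hvx]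
        exact hA
      · simp only [chartMatrix, Fin.mk_one, MvPolynomial.eval_C, MvPolynomial.eval_X,
          Matrix.cons_val, map_pow, map_mul, map_sub, hζ, hζ', ← hvy]
        exact hB

theorem algDependentOn_commutingReps (ht : 0 < t) :
    AlgDependentOn (repFunctions (torusGroupGen p t)) 3 (commutingReps p t) :=
  AlgDependentOn.mono (.union
    (.biUnion _ fun _ _ => algDependentOn_chartSet_laurent _ _ _ _ _)
    (.biUnion _ fun _ _ => algDependentOn_chartSet _ _ _ _ _)) (commutingReps_subset ht)

end CommutingDimension

/-! ### The trace strata: irreducible of dimension 4 -/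

section TraceReps

variable {p t : ℕ} {K : Fin 2 → ℕ} {w : Fin 2 → ℂ}

theorem exists_sq_eq_unityPow (p t : ℕ) (K : Fin 2 → ℕ) :
    ∃ w : Fin 2 → ℂ, ∀ i : Fin 2, w i ^ 2 = unityPow (![p, t] i) (K i) := by
  choose w hw using fun i => IsAlgClosed.exists_pow_nat_eq (unityPow (![p, t] i) (K i)) two_pos
  exact ⟨w, hw⟩

theorem exists_mem_traceReps (hp : 0 < p) (ht : 0 < t)
    (hw : ∀ i : Fin 2, w i ^ 2 = unityPow (![p, t] i) (K i)) (c u v : Fin 2 → ℂ) :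
    ∃ ρ ∈ traceReps p t K, ∃ g, RepVariety.toPow _ ρ = projPow 2 g ∧
      ∀ i, (g i).1 = conjUpper (c i) (u i) (w i) (v i * ((w i)⁻¹ - w i)) (w i)⁻¹ := by
  have hw0 := fun i => ne_zero_of_sq_eq_unityPow (hw i)
  let g : Fin 2 → SpecialLinearGroup (Fin 2) ℂ := fun i =>
    ⟨conjUpper (c i) (u i) (w i) (v i * ((w i)⁻¹ - w i)) (w i)⁻¹, by
      rw [conjUpper_det, mul_inv_cancel₀ (hw0 i)]⟩
  have hrel : (g 0).1 ^ p = (g 1).1 ^ t ∨ (g 0).1 ^ p = -(g 1).1 ^ t := by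
    rcases conjUpper_pow_of_sq_eq_unityPow hp (hw 0) (c 0) (u 0) (v 0) with h | h <;>
      rcases conjUpper_pow_of_sq_eq_unityPow ht (hw 1) (c 1) (u 1) (v 1) with h' | h' <;>
      simp [g, h, h']
  obtain ⟨ρ, hρ⟩ := exists_rep hrel
  refine ⟨ρ, (mem_traceReps_iff hρ).2 fun i => ?_, g, hρ, fun i => rfl⟩
  rw [traceSqValue, ← hw i, ← add_inv_sq (hw0 i)]
  exact congrArg (· ^ 2) (conjUpper_trace _ _ _ _ _)

/-- The squared trace fixes the trace up to sign, and changing the sign of the lift makes it `w i +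
(w i)⁻¹`. -/
theorem exists_lift_of_mem_traceReps (hK : ∀ i : Fin 2, K i ∈ Finset.Icc 1 (![p, t] i / 2))
    (hw : ∀ i : Fin 2, w i ^ 2 = unityPow (![p, t] i) (K i)) {ρ : RepVariety (torusGroupGen p t)}
    (hρ : ρ ∈ traceReps p t K) :
    ∃ (c u v : Fin 2 → ℂ) (g : Fin 2 → SpecialLinearGroup (Fin 2) ℂ), (∀ i, c i = 0 ∨ c i = 1) ∧
      RepVariety.toPow _ ρ = projPow 2 g ∧
      ∀ i, (g i).1 = conjUpper (c i) (u i) (w i) (v i * ((w i)⁻¹ - w i)) (w i)⁻¹ := by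
  obtain ⟨g, hg⟩ := exists_lift ρ
  have key : ∀ i, ∃ h : SpecialLinearGroup (Fin 2) ℂ, ((g i).1 = h.1 ∨ (g i).1 = -h.1) ∧
      h.1.trace = w i + (w i)⁻¹ := by
    intro i
    have htr := hρ g hg i
    rw [traceSqValue, ← hw i, ← add_inv_sq (ne_zero_of_sq_eq_unityPow (hw i))] at htr
    rcases sq_eq_sq_iff_eq_or_eq_neg.1 htr with h | h
    · exact ⟨g i, Or.inl rfl, h⟩
    · refine ⟨-g i, Or.inr (by simp), ?_⟩
      rw [← neg_eq_iff_eq_neg] at h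
      simpa using h
  choose h hgh htr using key
  choose c u v hc hh using fun i =>
    exists_conjUpper_of_trace (h i).2 (hK i) (hw i) (htr i)
  exact ⟨c, u, v, h, hc, hg.trans ((projPow_eq_iff g h).2 hgh), hh⟩

theorem algDependentOn_traceReps (hK : ∀ i : Fin 2, K i ∈ Finset.Icc 1 (![p, t] i / 2)) :
    AlgDependentOn (repFunctions (torusGroupGen p t)) 4 (traceReps p t K) := by
  obtain ⟨w, hw⟩ := exists_sq_eq_unityPow p t K
  refine AlgDependentOn.mono (.biUnion (Fintype.piFinset fun _ : Fin 2 => ({0, 1} : Finset ℂ))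
    fun c _ => algDependentOn_chartSet (fun i => MvPolynomial.C (c i))
      ![MvPolynomial.X 0, MvPolynomial.X 1] (fun i => MvPolynomial.C (w i))
      (fun i => ![MvPolynomial.X 2, MvPolynomial.X 3] i * MvPolynomial.C ((w i)⁻¹ - w i))
      (fun i => MvPolynomial.C (w i)⁻¹)) ?_
  intro ρ hρ
  obtain ⟨c, u, v, g, hc, hg, h⟩ := exists_lift_of_mem_traceReps hK hw hρ
  refine Set.mem_biUnion (x := c) ?_ ⟨![u 0, u 1, v 0, v 1], trivial, g, hg, ?_⟩
  · exact Finset.mem_coe.2 (Fintype.mem_piFinset.2 fun i => by simpa using hc i)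
  · intro i
    rw [h i]
    fin_cases i <;> simp [chartMatrix]

/-- A polynomial parametrization of `traceReps` by an affine space of dimension six. -/
theorem exists_parametrization (hp : 0 < p) (ht : 0 < t)
    (hw : ∀ i : Fin 2, w i ^ 2 = unityPow (![p, t] i) (K i)) :
    ∃ φ : (Fin 2 × Fin 3 → ℂ) → RepVariety (torusGroupGen p t), (∀ z, φ z ∈ traceReps p t K) ∧
      (∀ z, ∃ g, RepVariety.toPow _ (φ z) = projPow 2 g ∧
        ∀ i, (g i).1 =
          conjUpper (z (i, 0)) (z (i, 1)) (w i) (z (i, 2) * ((w i)⁻¹ - w i)) (w i)⁻¹) ∧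
      ∀ f ∈ repFunctions (torusGroupGen p t), ∃ P : MvPolynomial (Fin 2 × Fin 3) ℂ,
        ∀ z, f (φ z) = MvPolynomial.eval z P := by
  choose φ hφ g hg h using fun z : Fin 2 × Fin 3 → ℂ => exists_mem_traceReps hp ht hw
    (fun i => z (i, 0)) (fun i => z (i, 1)) (fun i => z (i, 2))
  refine ⟨φ, hφ, fun z => ⟨g z, hg z, h z⟩, fun f hf => ?_⟩
  obtain ⟨Q, hQ⟩ := exists_eval_chart (σ := Fin 2 × Fin 3)
    (fun i => MvPolynomial.X (i, 0)) (fun i => MvPolynomial.X (i, 1))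
    (fun i => MvPolynomial.C (w i))
    (fun i => MvPolynomial.X (i, 2) * MvPolynomial.C ((w i)⁻¹ - w i))
    (fun i => MvPolynomial.C (w i)⁻¹) hf
  refine ⟨Q, fun z => hQ z _ (g z) (hg z) fun i => ?_⟩
  rw [h z i]
  simp [chartMatrix]

/-- Letting each `c i` range over all of `ℂ`, not just `{0, 1}`, merges the charts into one
surjection from an affine space. -/
theorem isIrreducible_traceReps (hp : 0 < p) (ht : 0 < t)
    (hK : ∀ i : Fin 2, K i ∈ Finset.Icc 1 (![p, t] i / 2)) : IsIrreducible (traceReps p t K) := by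
  obtain ⟨w, hw⟩ := exists_sq_eq_unityPow p t K
  obtain ⟨φ, hφ, hφg, hφP⟩ := exists_parametrization hp ht hw
  have hrange : Set.range φ = traceReps p t K := by
    refine Set.Subset.antisymm (Set.range_subset_iff.2 hφ) fun ρ hρ => ?_
    obtain ⟨c, u, v, g, -, hg, h⟩ := exists_lift_of_mem_traceReps hK hw hρ
    let z : Fin 2 × Fin 3 → ℂ := fun s => ![c s.1, u s.1, v s.1] s.2
    obtain ⟨g', hg', h'⟩ := hφg z
    refine ⟨z, toPow_injective (hg'.trans (Eq.trans ?_ hg.symm))⟩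
    exact congrArg _ (funext fun i => Subtype.ext ((h' i).trans (h i).symm))
  rw [← hrange]
  exact (isZariski_repFunctions _).isIrreducible_range φ hφP

theorem not_traceReps_subset_commutingReps (hp : 0 < p) (ht : 0 < t)
    (hK : ∀ i : Fin 2, K i ∈ Finset.Icc 1 (![p, t] i / 2)) : ¬ traceReps p t K ⊆ commutingReps p t := by
  obtain ⟨w, hw⟩ := exists_sq_eq_unityPow p t K
  have hne := fun i => inv_sub_ne_zero_of_sq_eq_unityPow (hK i) (hw i)
  -- A lower triangular and an upper triangular matrix, both with nonzero off-diagonal entry.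
  obtain ⟨ρ, hρ, g, hg, h⟩ := exists_mem_traceReps hp ht hw 0 ![1, 0] ![0, 1]
  intro hsub
  have hcomm := congrFun (congrFun ((mem_commutingReps_iff hg).1 (hsub hρ)) 0) 0
  rw [h, h] at hcomm
  simp [conjUpper, Matrix.mul_apply, Fin.sum_univ_two] at hcomm
  have : ((w 0)⁻¹ - w 0) * ((w 1)⁻¹ - w 1) = 0 := by linear_combination hcomm
  exact mul_ne_zero (hne 0) (hne 1) this

/-- The square of a matrix entry of a generator is a regular function. -/
theorem exists_entrySq (i a b : Fin 2) :
    ∃ f ∈ repFunctions (torusGroupGen p t), ∀ ρ g, RepVariety.toPow _ ρ = projPow 2 g →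
      f ρ = (g i).1 a b ^ 2 := by
  obtain ⟨f, hf, h⟩ := exists_repFunction (s := torusGroupGen p t)
    (MvPolynomial.X (i, a, b) ^ 2) fun g g' hs => by
      simp only [map_pow, MvPolynomial.eval_X, entries]
      rcases hs i with h | h <;> simp [h]
  exact ⟨f, hf, fun ρ g hg => by simp [h ρ g hg, entries]⟩

theorem le_topologicalKrullDim_traceReps (hp : 0 < p) (ht : 0 < t)
    (hK : ∀ i : Fin 2, K i ∈ Finset.Icc 1 (![p, t] i / 2)) :
    (4 : ℕ) ≤ topologicalKrullDim (traceReps p t K) := by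
  obtain ⟨w, hw⟩ := exists_sq_eq_unityPow p t K
  have hne := fun i => inv_sub_ne_zero_of_sq_eq_unityPow (hK i) (hw i)
  have hne' := fun i => sub_ne_zero.2 (sub_ne_zero.1 (hne i)).symm
  obtain ⟨φ, hφ, hφg, hφP⟩ := exists_parametrization hp ht hw
  have hF := (isZariski_repFunctions (torusGroupGen p t)).pullback
    (Topology.IsInducing.subtypeVal (t := traceReps p t K))
  have hentry : ∀ i a b : Fin 2, ∃ f ∈ (repFunctions (torusGroupGen p t)).map
      (pullbackAlgHom (Subtype.val : traceReps p t K → _)), ∀ z,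
      f ⟨φ z, hφ z⟩ = conjUpper (z (i, 0)) (z (i, 1)) (w i) (z (i, 2) * ((w i)⁻¹ - w i))
        (w i)⁻¹ a b ^ 2 := by
    intro i a b
    obtain ⟨f, hf, h⟩ := exists_entrySq (p := p) (t := t) i a b
    refine ⟨_, ⟨f, hf, rfl⟩, fun z => ?_⟩
    obtain ⟨g, hg, hgz⟩ := hφg z
    rw [← hgz i]
    exact h _ g hg
  refine hF.le_topologicalKrullDim_of_masks (fun z => ⟨φ z, hφ z⟩) ?_
    -- Free, in turn, the first eigenline of generator 0, its second eigenline, then the same for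
    -- generator 1. The redundant `c` is freed together with `v`, so six parameters give four steps.
    -- The squared lower-left entry detects `u`, the squared upper-right one `v`.
    ![fun _ => 0, fun s => ![![0, 1, 0], ![0, 0, 0]] s.1 s.2,
      fun s => ![![1, 1, 1], ![0, 0, 0]] s.1 s.2, fun s => ![![1, 1, 1], ![0, 1, 0]] s.1 s.2,
      fun _ => 1] ?_ ?_
  · rintro _ ⟨f, hf, rfl⟩
    exact hφP f hf
  · intro i
    ext ⟨a, b⟩
    fin_cases i <;> fin_cases a <;> fin_cases b <;> simp
  · intro i
    fin_cases i
    · obtain ⟨f, hf, h⟩ := hentry 0 1 0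
      refine ⟨f, hf, fun z => ?_, fun _ => 1, ?_⟩
      · rw [h]; simp [conjUpper]
      · rw [h]; simpa [conjUpper] using hne' 0
    · obtain ⟨f, hf, h⟩ := hentry 0 0 1
      refine ⟨f, hf, fun z => ?_, fun s => ![0, 0, 1] s.2, ?_⟩
      · rw [h]; simp [conjUpper]
      · rw [h]; simpa [conjUpper] using hne 0
    · obtain ⟨f, hf, h⟩ := hentry 1 1 0
      refine ⟨f, hf, fun z => ?_, fun _ => 1, ?_⟩
      · rw [h]; simp [conjUpper]
      · rw [h]; simpa [conjUpper] using hne' 1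
    · obtain ⟨f, hf, h⟩ := hentry 1 0 1
      refine ⟨f, hf, fun z => ?_, fun s => ![0, 0, 1] s.2, ?_⟩
      · rw [h]; simp [conjUpper]
      · rw [h]; simpa [conjUpper] using hne 1

theorem topologicalKrullDim_traceReps (hp : 0 < p) (ht : 0 < t)
    (hK : ∀ i : Fin 2, K i ∈ Finset.Icc 1 (![p, t] i / 2)) :
    topologicalKrullDim (traceReps p t K) = (4 : ℕ) :=
  le_antisymm
    ((isZariski_repFunctions _).topologicalKrullDim_subtype_le (algDependentOn_traceReps hK))
    (le_topologicalKrullDim_traceReps hp ht hK)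

end TraceReps

/-! ### Counting the components -/

section Components

variable {p t : ℕ}

theorem subset_commutingReps_or_traceReps (hp : 0 < p) (ht : 0 < t)
    {W : Set (RepVariety (torusGroupGen p t))} (hW : IsIrreducible W) :
    W ⊆ commutingReps p t ∨
      ∃ K, (∀ i : Fin 2, K i ∈ Finset.Icc 1 (![p, t] i / 2)) ∧ W ⊆ traceReps p t K := by
  classical
  obtain ⟨Z, hZ, hWZ⟩ := isIrreducible_iff_sUnion_isClosed.1 hW
    (insert (commutingReps p t)
      ((Fintype.piFinset fun i : Fin 2 => Finset.Icc 1 (![p, t] i / 2)).image (traceReps p t)))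
    (by
      intro Z hZ
      rcases Finset.mem_insert.1 hZ with rfl | hZ
      · exact isClosed_commutingReps
      · obtain ⟨K, -, rfl⟩ := Finset.mem_image.1 hZ
        exact isClosed_traceReps K)
    (by
      intro ρ _
      rcases mem_commutingReps_or_traceReps hp ht ρ with h | ⟨K, hK, h⟩
      · exact ⟨_, Finset.mem_coe.2 (Finset.mem_insert_self _ _), h⟩
      · exact ⟨_, Finset.mem_coe.2 (Finset.mem_insert_of_mem
          (Finset.mem_image_of_mem _ (Fintype.mem_piFinset.2 hK))), h⟩)
  rcases Finset.mem_insert.1 hZ with rfl | hZ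
  · exact Or.inl hWZ
  · obtain ⟨K, hK, rfl⟩ := Finset.mem_image.1 hZ
    exact Or.inr ⟨K, Fintype.mem_piFinset.1 hK, hWZ⟩

/-- A component inside the commuting locus is too small, so a 4-dimensional one lies in a stratum
and equals it by maximality. Conversely, an irreducible set containing a stratum lies in some
stratum, necessarily the same one by disjointness. -/
theorem setOf_components_eq (hp : 0 < p) (ht : 0 < t) :
    {Z ∈ irreducibleComponents (RepVariety (torusGroupGen p t)) |
      topologicalKrullDim Z = ((4 : ℕ) : WithBot ℕ∞)} =
    traceReps p t '' (Fintype.piFinset fun i : Fin 2 => Finset.Icc 1 (![p, t] i / 2) : Finset (Fin 2 → ℕ)) := by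
  ext Z
  constructor
  · rintro ⟨hZ, hdim⟩
    rcases subset_commutingReps_or_traceReps hp ht hZ.1 with h | ⟨K, hK, h⟩
    · have hle := (isZariski_repFunctions (torusGroupGen p t)).topologicalKrullDim_subtype_le
        ((algDependentOn_commutingReps ht).mono h)
      rw [hdim] at hle
      have : 4 ≤ 3 := by exact_mod_cast hle
      omega
    · exact ⟨K, Finset.mem_coe.2 (Fintype.mem_piFinset.2 hK),
        (hZ.2 (isIrreducible_traceReps hp ht hK) h).antisymm h⟩
  · rintro ⟨K, hK, rfl⟩
    replace hK := Fintype.mem_piFinset.1 (Finset.mem_coe.1 hK)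
    have hirr := isIrreducible_traceReps hp ht hK
    refine ⟨⟨hirr, fun W hW hle => ?_⟩, topologicalKrullDim_traceReps hp ht hK⟩
    rcases subset_commutingReps_or_traceReps hp ht hW with h | ⟨K', hK', h⟩
    · exact (not_traceReps_subset_commutingReps hp ht hK (Set.Subset.trans hle h)).elim
    · obtain ⟨ρ, hρ⟩ := hirr.nonempty
      rwa [eq_of_mem_traceReps hK hK' hρ (h (hle hρ))]

theorem numComponents_torusGroup (hp : 0 < p) (ht : 0 < t) :
    numComponents (RepVariety (torusGroupGen p t)) 4 = ((p / 2 * (t / 2) : ℕ) : ℕ∞) := by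
  rw [numComponents, setOf_components_eq hp ht, Set.InjOn.encard_image, Set.encard_coe_eq_coe_finsetCard,
    Fintype.card_piFinset, Fin.prod_univ_two, Nat.card_Icc, Nat.card_Icc]
  · simp
  · intro K hK K' hK' h
    replace hK := Fintype.mem_piFinset.1 (Finset.mem_coe.1 hK)
    replace hK' := Fintype.mem_piFinset.1 (Finset.mem_coe.1 hK')
    obtain ⟨ρ, hρ⟩ := (isIrreducible_traceReps hp ht hK).nonempty
    exact eq_of_mem_traceReps hK hK' hρ (h ▸ hρ)

end Components

end

theorem proposition4p3 (p t : ℕ) (hp : 0 < p) (ht : 0 < t) :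
    ∃ N : ℕ, numComponents (RepVariety (torusGroupGen p t)) 4 = (N : ℕ∞) ∧
      (Odd p → Odd t → (N : ℚ) = ((p : ℚ) - 1) * ((t : ℚ) - 1) / 4) ∧
      (Even p → Odd t → (N : ℚ) = (p : ℚ) * ((t : ℚ) - 1) / 4) ∧
      (Odd p → Even t → (N : ℚ) = (t : ℚ) * ((p : ℚ) - 1) / 4) ∧
      (Even p → Even t → (N : ℚ) = (p : ℚ) * (t : ℚ) / 4) := by
  have hodd : ∀ n : ℕ, Odd n → ((n / 2 : ℕ) : ℚ) = ((n : ℚ) - 1) / 2 := by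
    rintro n ⟨m, rfl⟩
    rw [show (2 * m + 1) / 2 = m by omega]
    push_cast
    ring
  have heven : ∀ n : ℕ, Even n → ((n / 2 : ℕ) : ℚ) = (n : ℚ) / 2 := by
    rintro n ⟨m, rfl⟩
    rw [show (m + m) / 2 = m by omega]
    push_cast
    ring
  refine ⟨p / 2 * (t / 2), numComponents_torusGroup hp ht, ?_, ?_, ?_, ?_⟩ <;> intro h h' <;>
    rw [Nat.cast_mul]
  · rw [hodd p h, hodd t h']; ring
  · rw [heven p h, hodd t h']; ring
  · rw [hodd p h, heven t h']; ring
  · rw [heven p h, heven t h']; ring
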